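/- Let $R$ be $\mathbb{Z}$, $\mathbb{Q}$ or $\mathbb{Z}_p$ (the integers modulo a prime $p$). For a group $A$ let $\{A^R_n\}_{n\ge 1}$ be the $R$-lower central series: $A^R_1=A$ and $$A^{\mathbb Z}_{n+1}=[A,A^{\mathbb Z}_n],\qquad A^{\mathbb Q}_{n+1}=\{x\in A\mid x^k\in[A,A^{\mathbb Q}_n]\text{ for some integer }k>0\},\qquad A^{\mathbb Z_p}_{n+1}=(A^{\mathbb Z_p}_n)^p\,[A^{\mathbb Z_p}_n,A],$$ where $(\cdot)^p$ denotes the subgroup generated by all $p$-th powers. The lower central series is $A_n=A^{\mathbb Z}_n$. For $n\ge 1$ let $\Phi^R_n(A)=\ker\bigl(H_2(A;R)\to H_2(A/A^R_n;R)\bigr)$, and let $\mathcal H^n=(\mathcal H^R_{Dwyer})^n$ be the class of group homomorphisms $f:A\to B$ that induce an isomorphism $H_1(A;R)\to H_1(B;R)$ and an epimorphism $H_2(A;R)/\Phi^R_n(A)\to H_2(B;R)/\Phi^R_n(B)$; put $\mathcal H^0=\mathcal H^1$. The collection $\{\mathcal H^n\}_{n\ge 0}$ is the Dwyer $R$-class.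 A series $\{\Gamma^n\}_{n\ge 0}$ assigns to each group $A$ normal subgroups $A=\Gamma^0(A)\supseteq\Gamma^1(A)\supseteq\Gamma^2(A)\supseteq\cdots$ of $A$. It is invariant under the Dwyer $R$-class if $f(\Gamma^n(A))\subseteq\Gamma^n(B)$ for all $n\ge0$ and all $f:A\to B$ in $\mathcal H^n$. Its stabilization under the Dwyer $R$-class is given by $$\Gamma^n_S(A)=\{a\in A\mid f(a)\in\Gamma^n(B)\text{ for some group }B\text{ and some }f:A\to B\text{ in }\mathcal H^n\}.$$ **Proposition.** The stabilization under the Dwyer $R$-class of the lower central series $\Gamma^n(A)=A_{n+1}$ is the $R$-lower central series: $\Gamma^n_S(A)=A^R_{n+1}$ for every group $A$ and every $n\ge 0$. More generally, if $\{\Gamma^n\}$ is any series that is invariant under the Dwyer $R$-class and satisfies $\Gamma^n(A)\subseteq A^R_{n+1}$ for all groups $A$ and all $n\ge0$, then $\Gamma^n_S(A)=A^R_{n+1}$ for every group $A$ and every $n\ge0$. -/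

import Mathlib

universe u

namespace DwyerStability

/-- The coefficient rings: the integers, the rationals, or the integers modulo a prime. -/
inductive CoeffRing : Type
  | int : CoeffRing
  | rat : CoeffRing
  | zmod (p : ℕ) (hp : p.Prime) : CoeffRing

/-- The underlying ring of a choice of coefficients, lifted to the universe of the groups
under consideration. -/
def CoeffRing.Carrier : CoeffRing → Type u
  | .int => ULift.{u} ℤ
  | .rat => ULift.{u} ℚ
  | .zmod p _ => ULift.{u} (ZMod p)

noncomputable instance (R : CoeffRing) : CommRing (CoeffRing.Carrier.{u} R) :=
  match R with
  | .int => inferInstanceAs (CommRing (ULift.{u} ℤ))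
  | .rat => inferInstanceAs (CommRing (ULift.{u} ℚ))
  | .zmod p _ => inferInstanceAs (CommRing (ULift.{u} (ZMod p)))

/-! ### Subgroup functions, series, classes of maps, stabilization -/

/-- A (normal) subgroup function on the category of all groups. -/
structure SubgroupFunction where
  sub : ∀ (A : Type u) [Group A], Subgroup A
  normal : ∀ (A : Type u) [Group A], (sub A).Normal

/-- A (normal) series on the category of all groups, indexed from `0`, with `Γ⁰(A) = A`. -/
structure NormalSeries where
  term : ℕ → SubgroupFunction.{u}
  succ_le : ∀ (n : ℕ) (A : Type u) [Group A], (term (n + 1)).sub A ≤ (term n).sub A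
  zero_eq : ∀ (A : Type u) [Group A], (term 0).sub A = ⊤

/-- A collection of group homomorphisms. -/
abbrev MapClass : Type (u + 1) :=
  ∀ (A B : Type u) [Group A] [Group B], (A →* B) → Prop

/-- `Γ` is `H`-invariant: `f (Γ A) ⊆ Γ B` for each `f : A → B` in `H`. -/
def SubgroupFunction.IsInvariant (Γ : SubgroupFunction.{u}) (H : MapClass.{u}) : Prop :=
  ∀ (A B : Type u) [Group A] [Group B] (f : A →* B), H A B f → ∀ a ∈ Γ.sub A, f a ∈ Γ.sub B

/-- A series is invariant if its `n`-th term is invariant under the `n`-th class of maps. -/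
def NormalSeries.IsInvariant (Γ : NormalSeries.{u}) (H : ℕ → MapClass.{u}) : Prop :=
  ∀ n, (Γ.term n).IsInvariant (H n)

/-- The stabilization `Γ_S(A)` of a subgroup function with respect to a class of maps. -/
def SubgroupFunction.stabilization (Γ : SubgroupFunction.{u}) (H : MapClass.{u})
    (A : Type u) [Group A] : Set A :=
  {a | ∃ (B : Type u) (_ : Group B) (f : A →* B), H A B f ∧ f a ∈ Γ.sub B}

/-! ### The `R`-lower central series -/

section Terms

variable {A B : Type u} [Group A] [Group B]

/-- One step `A^R_n ↦ A^R_{n+1}` of the `R`-lower central series. -/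
def rStep (R : CoeffRing) (H : Subgroup A) : Subgroup A :=
  match R with
  | .int => ⁅(⊤ : Subgroup A), H⁆
  | .rat => Subgroup.closure {x | ∃ k : ℕ, 0 < k ∧ x ^ k ∈ ⁅(⊤ : Subgroup A), H⁆}
  | .zmod p _ => Subgroup.closure {x | ∃ y ∈ H, y ^ p = x} ⊔ ⁅H, (⊤ : Subgroup A)⁆

variable (A) in
/-- `rTerm R A n` is the term `A^R_{n+1}` of the `R`-lower central series of `A`. -/
def rTerm (R : CoeffRing) : ℕ → Subgroup A
  | 0 => ⊤
  | n + 1 => rStep R (rTerm R n)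

theorem map_commutator_top_le (f : A →* B) {H : Subgroup A} {K : Subgroup B}
    (h : H.map f ≤ K) : (⁅(⊤ : Subgroup A), H⁆).map f ≤ ⁅(⊤ : Subgroup B), K⁆ := by
  rw [Subgroup.map_commutator]
  exact Subgroup.commutator_mono le_top h

theorem map_rStep_le (R : CoeffRing) (f : A →* B) {H : Subgroup A} {K : Subgroup B}
    (h : H.map f ≤ K) : (rStep R H).map f ≤ rStep R K := by
  have hc := map_commutator_top_le f h
  cases R with
  | int => exact hc
  | rat =>
    simp only [rStep, MonoidHom.map_closure]
    apply Subgroup.closure_mono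
    rintro _ ⟨x, ⟨k, hk, hx⟩, rfl⟩
    exact ⟨k, hk, by rw [← map_pow]; exact hc ⟨_, hx, rfl⟩⟩
  | zmod p hp =>
    simp only [rStep, Subgroup.map_sup, MonoidHom.map_closure]
    apply sup_le_sup
    · apply Subgroup.closure_mono
      rintro _ ⟨_, ⟨y, hy, rfl⟩, rfl⟩
      exact ⟨f y, h ⟨y, hy, rfl⟩, by rw [map_pow]⟩
    · rw [Subgroup.commutator_comm H, Subgroup.commutator_comm K]
      exact hc

theorem map_rTerm_le (R : CoeffRing) (f : A →* B) (n : ℕ) :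
    (rTerm A R n).map f ≤ rTerm B R n := by
  induction n with
  | zero => exact le_top
  | succ n ih => exact map_rStep_le R f ih

instance rTerm_normal (R : CoeffRing) (n : ℕ) : (rTerm A R n).Normal :=
  ⟨fun x hx g => map_rTerm_le R (MulAut.conj g).toMonoidHom n ⟨x, hx, rfl⟩⟩

theorem rTerm_succ_le (R : CoeffRing) (n : ℕ) : rTerm A R (n + 1) ≤ rTerm A R n := by
  cases R with
  | int => exact Subgroup.commutator_le_right _ _
  | rat =>
    induction n with
    | zero => exact le_top
    | succ n ih =>
      apply Subgroup.closure_mono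
      rintro x ⟨k, hk, hx⟩
      exact ⟨k, hk, Subgroup.commutator_mono le_rfl ih hx⟩
  | zmod p hp =>
    apply sup_le
    · rw [Subgroup.closure_le]
      rintro _ ⟨y, hy, rfl⟩
      exact pow_mem hy p
    · exact Subgroup.commutator_le_left _ _

/-- In the rational case the generating set of each term is already a subgroup. -/
theorem mem_rTerm_rat_succ (n : ℕ) (x : A) :
    x ∈ rTerm A .rat (n + 1) ↔
      ∃ k : ℕ, 0 < k ∧ x ^ k ∈ ⁅(⊤ : Subgroup A), rTerm A .rat n⁆ := by
  refine ⟨fun hx => ?_, fun hx => Subgroup.subset_closure hx⟩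
  have hmem : ∀ z ∈ {z : A | ∃ k : ℕ, 0 < k ∧ z ^ k ∈ ⁅(⊤ : Subgroup A), rTerm A .rat n⁆},
      z ∈ rTerm A .rat n := fun z hz => rTerm_succ_le .rat n (Subgroup.subset_closure hz)
  induction hx using Subgroup.closure_induction with
  | mem z hz => exact hz
  | one => exact ⟨1, one_pos, by simp⟩
  | inv z _ ih =>
    obtain ⟨k, hk, h⟩ := ih
    exact ⟨k, hk, by rw [inv_pow]; exact inv_mem h⟩
  | mul y z _ _ ihy ihz =>
    have hz := hmem z ihz
    obtain ⟨k, hk, h1⟩ := ihy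
    obtain ⟨l, hl, h2⟩ := ihz
    refine ⟨k * l, Nat.mul_pos hk hl, ?_⟩
    have hcomm : Commute (y : A ⧸ ⁅(⊤ : Subgroup A), rTerm A .rat n⁆) (z : A ⧸ _) := by
      rw [Commute, SemiconjBy, ← QuotientGroup.mk_mul, ← QuotientGroup.mk_mul, eq_comm,
        QuotientGroup.eq]
      have := Subgroup.commutator_mem_commutator (Subgroup.mem_top y⁻¹) (inv_mem hz)
      rw [← inv_mem_iff] at this
      simpa [commutatorElement_def, mul_assoc] using
        Subgroup.commutator_mem_commutator (Subgroup.mem_top y⁻¹) (inv_mem hz)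
    rw [← QuotientGroup.eq_one_iff] at h1 h2 ⊢
    rw [QuotientGroup.mk_pow] at h1 h2 ⊢
    rw [QuotientGroup.mk_mul, hcomm.mul_pow, pow_mul, h1, mul_comm k l, pow_mul, h2]
    simp

end Terms

/-- The `R`-lower central series, indexed so that its `n`-th term at `A` is `A^R_{n+1}`. -/
def rLowerCentralSeries (R : CoeffRing) : NormalSeries.{u} where
  term n := { sub := fun A _ => rTerm A R n, normal := fun _ _ => rTerm_normal R n }
  succ_le n _ _ := rTerm_succ_le R n
  zero_eq _ _ := rfl

/-- The lower central series, indexed so that its `n`-th term at `A` is `A_{n+1}`. -/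
def lowerCentral : NormalSeries.{u} where
  term n :=
    { sub := fun A _ => (⊤ : Subgroup A).lowerCentralSeries n
      normal := fun _ _ => inferInstance }
  succ_le n _ _ := Subgroup.lowerCentralSeries_antitone _ n.le_succ
  zero_eq _ _ := rfl

/-- The lower central series is invariant under every collection of classes of maps. -/
theorem lowerCentral_isInvariant (H : ℕ → MapClass.{u}) : lowerCentral.IsInvariant H := by
  intro n A B _ _ f _ a ha
  have h : ((⊤ : Subgroup A).lowerCentralSeries n).map f ≤ (⊤ : Subgroup B).lowerCentralSeries n := by
    rw [Subgroup.map_lowerCentralSeries]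
    exact Subgroup.lowerCentralSeries_mono n le_top
  exact h ⟨a, ha, rfl⟩

/-! ### Homology with trivial coefficients and the Dwyer `R`-class -/

section Homology

variable (R : CoeffRing)

/-- `H_i(A; R)`: group homology with trivial coefficients. -/
noncomputable abbrev homology (A : Type u) [Group A] (i : ℕ) :
    ModuleCat.{u} (CoeffRing.Carrier.{u} R) :=
  groupHomology (Rep.trivial (CoeffRing.Carrier.{u} R) A (CoeffRing.Carrier.{u} R)) i

open CategoryTheory in
/-- The identity of the coefficients, as a map of trivial modules over `f : A → B`. -/
noncomputable def coeffHom {A B : Type u} [Group A] [Group B] (f : A →* B) :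
    Rep.trivial (CoeffRing.Carrier.{u} R) A (CoeffRing.Carrier.{u} R) ⟶
      Rep.res f (Rep.trivial (CoeffRing.Carrier.{u} R) B (CoeffRing.Carrier.{u} R)) :=
  Rep.ofHom ⟨LinearMap.id, fun _ => rfl⟩

/-- The map `H_i(A; R) → H_i(B; R)` induced by a homomorphism `f : A → B`. -/
noncomputable def homologyMap {A B : Type u} [Group A] [Group B] (f : A →* B) (i : ℕ) :
    homology R A i →ₗ[CoeffRing.Carrier.{u} R] homology R B i :=
  (groupHomology.map f (coeffHom R f) i).hom

theorem homologyMap_comp {A B C : Type u} [Group A] [Group B] [Group C]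
    (g : B →* C) (f : A →* B) (i : ℕ) :
    homologyMap R (g.comp f) i = homologyMap R g i ∘ₗ homologyMap R f i := by
  have h := groupHomology.map_comp f g (coeffHom R f) (coeffHom R g) i
  have h' := congrArg ModuleCat.Hom.hom h
  rw [ModuleCat.hom_comp] at h'
  rw [homologyMap, homologyMap, homologyMap, ← h']
  exact congrArg ModuleCat.Hom.hom (groupHomology.map_congr rfl rfl i)

/-- `Φ^R_n(A)`, the kernel of `H_2(A; R) → H_2(A / A^R_n; R)`. Here `A^R_n` is the term of
index `n - 1` of the series; for `n = 0` the convention is `A^R_0 = A`. -/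
noncomputable def Phi (n : ℕ) (A : Type u) [Group A] :
    Submodule (CoeffRing.Carrier.{u} R) (homology R A 2) :=
  LinearMap.ker (homologyMap R (QuotientGroup.mk' (rTerm A R (n - 1))) 2)

theorem Phi_le_comap (n : ℕ) {A B : Type u} [Group A] [Group B] (f : A →* B) :
    Phi R n A ≤ (Phi R n B).comap (homologyMap R f 2) := by
  intro x hx
  have hsq : (QuotientGroup.mk' (rTerm B R (n - 1))).comp f =
      (QuotientGroup.map _ _ f (Subgroup.map_le_iff_le_comap.1 (map_rTerm_le R f (n - 1)))).comp
        (QuotientGroup.mk' (rTerm A R (n - 1))) := rfl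
  rw [Phi, LinearMap.mem_ker] at hx
  rw [Submodule.mem_comap, Phi, LinearMap.mem_ker, ← LinearMap.comp_apply, ← homologyMap_comp,
    hsq, homologyMap_comp, LinearMap.comp_apply, hx, map_zero]

/-- The induced map `H_2(A; R) / Φ^R_n(A) → H_2(B; R) / Φ^R_n(B)`. -/
noncomputable def phiQuotientMap (n : ℕ) {A B : Type u} [Group A] [Group B] (f : A →* B) :
    (homology R A 2 ⧸ Phi R n A) →ₗ[CoeffRing.Carrier.{u} R] (homology R B 2 ⧸ Phi R n B) :=
  Submodule.mapQ _ _ (homologyMap R f 2) (Phi_le_comap R n f)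

/-- The Dwyer `R`-class: the `n`-th class consists of the maps inducing an isomorphism on
`H_1(-; R)` and an epimorphism `H_2(A; R) / Φ^R_n(A) → H_2(B; R) / Φ^R_n(B)`. -/
def dwyerClass (n : ℕ) : MapClass.{u} := fun _ _ _ _ f =>
  Function.Bijective (homologyMap R f 1) ∧ Function.Surjective (phiQuotientMap R n f)

end Homology

end DwyerStability

/-!
Write `A_n` for the `R`-lower central series term `A^R_n`. Both parts of the statement follow from
two facts, valid for each `R`.

* *The projection `A → A / A_{n+1}` lies in the `n`-th Dwyer class* for `n ≥ 1` (`dwyerClass_mk`).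
  It sends all of `A_{n+1}` to `1`, hence into the `n`-th term of whatever series, so the
  stabilization contains `A_{n+1}`. On `2`-cycles one lifts to a chain on `A` and has to cancel
  its boundary by that of a chain which is trivial over `A / A_n`. The obstruction lives in an
  `R`-module and is additive on products with a factor in `A_n`; such functions vanish on
  `A_{n+1}` (`eq_zero_of_mem_rStep`).

* *Dwyer's theorem: if `f : A → B` is in the `n`-th class and `f a ∈ B_{n+1}`, then `a ∈ A_{n+1}`*
  (`mem_rTerm_of_map_mem_rTerm`). Hence the stabilization of a series below the `R`-lower central
  series is below it too. Call a group a tower of height `n` if it arises from the trivial group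
  by `n` successive central extensions by `R`-modules; then its `(n+1)`-st term is trivial. Each
  map from `A` to such a tower extends along `f` to `B`, one central extension at a time
  (`exists_extension_of_central`, `IsTower.exists_extension`). So it suffices to map `A` to a
  tower of height `n` with kernel inside `A_{n+1}`.

For `R = ℤ` and `R = ℤ/p` the group `A / A_{n+1}` is such a tower (`isTower_quotient`). For `R =
ℚ` its successive kernels are torsion-free but not divisible, and the tower is found in the group
algebra instead: the units `≡ 1` of `ℚ[A]` modulo the elements of weight at least `n + 1`, where
`g - 1` has weight `i` if `g ∈ A_i`. The kernel is controlled by a theorem of Lazard and Jennings: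
`g - 1` has weight at least `k` only if `g ∈ A_k` (`mem_of_sub_one_mem_weightFilt`). Its proof
descends through the terms of the series, adjoining to a subgroup `N` one element `x` at a time:
`N⟨x⟩ = N ⋊ ⟨x⟩` acts on `ℚ[N]`, with `N` multiplying and `x` conjugating, compatibly with weights
(`Detects.of_splitting`).
-/

namespace DwyerStability

open MonoidAlgebra (of)

/-! ### The bar complex in low degrees -/

section Bar

variable {A B C : Type u} [Group A] [Group B] [Group C] (k : Type u) [CommRing k]

variable (A) in
/-- The differential `C₂(A; k) → C₁(A; k)` of the inhomogeneous bar complex. -/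
noncomputable def barD2 : (A × A →₀ k) →ₗ[k] (A →₀ k) :=
  Finsupp.linearCombination k fun g =>
    Finsupp.single g.2 1 - Finsupp.single (g.1 * g.2) 1 + Finsupp.single g.1 1

variable (A) in
/-- The differential `C₃(A; k) → C₂(A; k)` of the inhomogeneous bar complex. -/
noncomputable def barD3 : (A × A × A →₀ k) →ₗ[k] (A × A →₀ k) :=
  Finsupp.linearCombination k fun g =>
    Finsupp.single (g.2.1, g.2.2) 1 - Finsupp.single (g.1 * g.2.1, g.2.2) 1 +
      Finsupp.single (g.1, g.2.1 * g.2.2) 1 - Finsupp.single (g.1, g.2.1) 1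

/-- The map `C₁(A; k) → C₁(B; k)` induced by `f : A → B`. -/
noncomputable def barMap1 (f : A →* B) : (A →₀ k) →ₗ[k] (B →₀ k) :=
  Finsupp.lmapDomain k k f

/-- The map `C₂(A; k) → C₂(B; k)` induced by `f : A → B`. -/
noncomputable def barMap2 (f : A →* B) : (A × A →₀ k) →ₗ[k] (B × B →₀ k) :=
  Finsupp.lmapDomain k k (Prod.map f f)

/-- The map `C₃(A; k) → C₃(B; k)` induced by `f : A → B`. -/
noncomputable def barMap3 (f : A →* B) : (A × A × A →₀ k) →ₗ[k] (B × B × B →₀ k) :=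
  Finsupp.lmapDomain k k (Prod.map f (Prod.map f f))

variable {k}

@[simp]
theorem barD2_single (g : A × A) (r : k) : barD2 A k (Finsupp.single g r) =
    Finsupp.single g.2 r - Finsupp.single (g.1 * g.2) r + Finsupp.single g.1 r := by
  simp [barD2, smul_sub, smul_add]

@[simp]
theorem barD3_single (g : A × A × A) (r : k) : barD3 A k (Finsupp.single g r) =
    Finsupp.single (g.2.1, g.2.2) r - Finsupp.single (g.1 * g.2.1, g.2.2) r +
      Finsupp.single (g.1, g.2.1 * g.2.2) r - Finsupp.single (g.1, g.2.1) r := by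
  simp [barD3, smul_sub, smul_add]

@[simp]
theorem barMap1_single (f : A →* B) (a : A) (r : k) :
    barMap1 k f (Finsupp.single a r) = Finsupp.single (f a) r := by
  simp [barMap1]

@[simp]
theorem barMap2_single (f : A →* B) (a : A × A) (r : k) :
    barMap2 k f (Finsupp.single a r) = Finsupp.single (f a.1, f a.2) r := by
  simp [barMap2, Prod.map]

@[simp]
theorem barMap3_single (f : A →* B) (a : A × A × A) (r : k) :
    barMap3 k f (Finsupp.single a r) = Finsupp.single (f a.1, f a.2.1, f a.2.2) r := by
  simp [barMap3, Prod.map]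

theorem barD2_barMap2 (f : A →* B) (x : A × A →₀ k) :
    barD2 B k (barMap2 k f x) = barMap1 k f (barD2 A k x) := by
  have : barD2 B k ∘ₗ barMap2 k f = barMap1 k f ∘ₗ barD2 A k := by
    refine Finsupp.lhom_ext fun a r => ?_
    simp
  exact LinearMap.congr_fun this x

theorem barD3_barMap3 (f : A →* B) (x : A × A × A →₀ k) :
    barD3 B k (barMap3 k f x) = barMap2 k f (barD3 A k x) := by
  have : barD3 B k ∘ₗ barMap3 k f = barMap2 k f ∘ₗ barD3 A k := by
    refine Finsupp.lhom_ext fun a r => ?_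
    simp
  exact LinearMap.congr_fun this x

theorem barMap2_comp (g : B →* C) (f : A →* B) (x : A × A →₀ k) :
    barMap2 k (g.comp f) x = barMap2 k g (barMap2 k f x) := by
  have : barMap2 k (g.comp f) = barMap2 k g ∘ₗ barMap2 k f := by
    refine Finsupp.lhom_ext fun a r => ?_
    simp
  exact LinearMap.congr_fun this x

theorem barMap2_mem_range_barD3 (f : A →* B) {x : A × A →₀ k}
    (hx : x ∈ LinearMap.range (barD3 A k)) : barMap2 k f x ∈ LinearMap.range (barD3 B k) := by
  obtain ⟨y, rfl⟩ := hx
  exact ⟨_, barD3_barMap3 f y⟩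

end Bar

/-! ### Homology classes of bar cycles -/

section Interface

variable (R : CoeffRing) {A B : Type u} [Group A] [Group B]

open groupHomology

theorem d₂₁_trivial_eq (x : A × A →₀ R.Carrier) :
    (d₂₁ (Rep.trivial R.Carrier A R.Carrier)).hom x = barD2 A R.Carrier x := by
  have : (d₂₁ (Rep.trivial R.Carrier A R.Carrier)).hom = barD2 A R.Carrier := by
    refine Finsupp.lhom_ext fun a r => ?_
    exact (d₂₁_single (A := Rep.trivial R.Carrier A R.Carrier) a r).trans (barD2_single a r).symm
  exact LinearMap.congr_fun this x

theorem d₃₂_trivial_eq (x : A × A × A →₀ R.Carrier) :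
    (d₃₂ (Rep.trivial R.Carrier A R.Carrier)).hom x = barD3 A R.Carrier x := by
  have : (d₃₂ (Rep.trivial R.Carrier A R.Carrier)).hom = barD3 A R.Carrier := by
    refine Finsupp.lhom_ext fun a r => ?_
    exact (d₃₂_single (A := Rep.trivial R.Carrier A R.Carrier) a r).trans (barD3_single a r).symm
  exact LinearMap.congr_fun this x

theorem chainsMap₁_eq (f : A →* B) (x : A →₀ R.Carrier) :
    (chainsMap₁ f (coeffHom R f)).hom x = barMap1 R.Carrier f x := by
  have : (chainsMap₁ f (coeffHom R f)).hom = barMap1 R.Carrier f := by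
    refine Finsupp.lhom_ext fun a r => ?_
    simp [chainsMap₁, barMap1, coeffHom]
  exact LinearMap.congr_fun this x

theorem chainsMap₂_eq (f : A →* B) (x : A × A →₀ R.Carrier) :
    (chainsMap₂ f (coeffHom R f)).hom x = barMap2 R.Carrier f x := by
  have : (chainsMap₂ f (coeffHom R f)).hom = barMap2 R.Carrier f := by
    refine Finsupp.lhom_ext fun a r => ?_
    simp [chainsMap₂, barMap2, coeffHom, Prod.map]
  exact LinearMap.congr_fun this x

variable (A) in
/-- The class in `H₁(A; R)` of a `1`-chain; for trivial coefficients each `1`-chain is a cycle. -/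
noncomputable def homologyClass1 : (A →₀ R.Carrier) →ₗ[R.Carrier] homology.{u} R A 1 :=
  (H1π (Rep.trivial R.Carrier A R.Carrier)).hom ∘ₗ
    LinearMap.codRestrict (cycles₁ (Rep.trivial R.Carrier A R.Carrier)) LinearMap.id
      (fun x => by rw [cycles₁_eq_top_of_isTrivial]; trivial)

variable (A) in
/-- The class in `H₂(A; R)` of a `2`-cycle. -/
noncomputable def homologyClass2 :
    LinearMap.ker (barD2 A R.Carrier) →ₗ[R.Carrier] homology.{u} R A 2 :=
  (H2π (Rep.trivial R.Carrier A R.Carrier)).hom ∘ₗ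
    LinearMap.codRestrict (cycles₂ (Rep.trivial R.Carrier A R.Carrier)) (Submodule.subtype _)
      (fun x => (d₂₁_trivial_eq R x.1).trans x.2)

theorem homologyClass1_surjective : Function.Surjective (homologyClass1 R A) := by
  intro z
  induction z using H1_induction_on with
  | h x => exact ⟨x.1, rfl⟩

theorem homologyClass2_surjective : Function.Surjective (homologyClass2 R A) := by
  intro z
  induction z using H2_induction_on with
  | h x => exact ⟨⟨x.1, (d₂₁_trivial_eq R x.1).symm.trans x.2⟩, rfl⟩

theorem homologyClass1_eq_zero_iff (x : A →₀ R.Carrier) :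
    homologyClass1 R A x = 0 ↔ x ∈ LinearMap.range (barD2 A R.Carrier) := by
  refine (H1π_eq_zero_iff _).trans ?_
  exact exists_congr fun y => by rw [← d₂₁_trivial_eq]; rfl

theorem homologyClass2_eq_zero_iff (x : LinearMap.ker (barD2 A R.Carrier)) :
    homologyClass2 R A x = 0 ↔ x.1 ∈ LinearMap.range (barD3 A R.Carrier) := by
  refine (H2π_eq_zero_iff _).trans ?_
  exact exists_congr fun y => by rw [← d₃₂_trivial_eq]; rfl

theorem homologyMap_homologyClass1 (f : A →* B) (x : A →₀ R.Carrier) :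
    homologyMap R f 1 (homologyClass1 R A x) = homologyClass1 R B (barMap1 R.Carrier f x) := by
  refine (H1π_comp_map_apply f (coeffHom R f) _).trans ?_
  refine congrArg (H1π (Rep.trivial R.Carrier B R.Carrier)).hom (Subtype.ext ?_)
  exact chainsMap₁_eq R f x

theorem homologyMap_homologyClass2 (f : A →* B) (x : LinearMap.ker (barD2 A R.Carrier))
    (hx : barMap2 R.Carrier f x.1 ∈ LinearMap.ker (barD2 B R.Carrier)) :
    homologyMap R f 2 (homologyClass2 R A x) =
      homologyClass2 R B ⟨barMap2 R.Carrier f x.1, hx⟩ := by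
  refine (H2π_comp_map_apply f (coeffHom R f) _).trans ?_
  refine congrArg (H2π (Rep.trivial R.Carrier B R.Carrier)).hom (Subtype.ext ?_)
  exact chainsMap₂_eq R f x.1

theorem barMap2_mem_ker (f : A →* B) {x : A × A →₀ R.Carrier}
    (hx : x ∈ LinearMap.ker (barD2 A R.Carrier)) :
    barMap2 R.Carrier f x ∈ LinearMap.ker (barD2 B R.Carrier) := by
  rw [LinearMap.mem_ker] at hx ⊢
  rw [barD2_barMap2, hx, map_zero]

theorem surjective_homologyMap_one_iff (f : A →* B) :
    Function.Surjective (homologyMap R f 1) ↔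
      ∀ y : B →₀ R.Carrier, ∃ x : A →₀ R.Carrier,
        y - barMap1 R.Carrier f x ∈ LinearMap.range (barD2 B R.Carrier) := by
  simp only [← homologyClass1_eq_zero_iff, map_sub, sub_eq_zero, ← homologyMap_homologyClass1]
  refine ⟨fun h y => ?_, fun h z => ?_⟩
  · obtain ⟨z, hz⟩ := h (homologyClass1 R B y)
    obtain ⟨x, rfl⟩ := homologyClass1_surjective R z
    exact ⟨x, hz.symm⟩
  · obtain ⟨y, rfl⟩ := homologyClass1_surjective R z
    obtain ⟨x, hx⟩ := h y
    exact ⟨_, hx.symm⟩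

theorem injective_homologyMap_one_iff (f : A →* B) :
    Function.Injective (homologyMap R f 1) ↔
      ∀ x : A →₀ R.Carrier, barMap1 R.Carrier f x ∈ LinearMap.range (barD2 B R.Carrier) →
        x ∈ LinearMap.range (barD2 A R.Carrier) := by
  rw [injective_iff_map_eq_zero, (homologyClass1_surjective R).forall]
  simp only [homologyMap_homologyClass1, homologyClass1_eq_zero_iff]

theorem surjective_phiQuotientMap_iff (n : ℕ) (f : A →* B) :
    Function.Surjective (phiQuotientMap R n f) ↔
      ∀ z : B × B →₀ R.Carrier, barD2 B R.Carrier z = 0 →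
        ∃ x : A × A →₀ R.Carrier, barD2 A R.Carrier x = 0 ∧
          barMap2 R.Carrier (QuotientGroup.mk' (rTerm B R (n - 1))) (z - barMap2 R.Carrier f x) ∈
            LinearMap.range (barD3 (B ⧸ rTerm B R (n - 1)) R.Carrier) := by
  have key : ∀ (z : LinearMap.ker (barD2 B R.Carrier)) (x : LinearMap.ker (barD2 A R.Carrier)),
      phiQuotientMap R n f (Submodule.Quotient.mk (homologyClass2 R A x)) =
        Submodule.Quotient.mk (homologyClass2 R B z) ↔
      barMap2 R.Carrier (QuotientGroup.mk' (rTerm B R (n - 1))) (z - barMap2 R.Carrier f x) ∈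
            LinearMap.range (barD3 (B ⧸ rTerm B R (n - 1)) R.Carrier) := by
    intro z x
    have hx := barMap2_mem_ker R f x.2
    rw [eq_comm, phiQuotientMap, Submodule.mapQ_apply, Submodule.Quotient.eq,
      homologyMap_homologyClass2 R f x hx, ← map_sub, Phi, LinearMap.mem_ker,
      homologyMap_homologyClass2 R _ _ (barMap2_mem_ker R _ (Subtype.prop _)),
      homologyClass2_eq_zero_iff]
    rfl
  refine ⟨fun h z hz => ?_, fun h q => ?_⟩
  · obtain ⟨q, hq⟩ := h (Submodule.Quotient.mk (homologyClass2 R B ⟨z, LinearMap.mem_ker.2 hz⟩))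
    obtain ⟨c, rfl⟩ := Submodule.Quotient.mk_surjective _ q
    obtain ⟨x, rfl⟩ := homologyClass2_surjective R c
    exact ⟨x.1, LinearMap.mem_ker.1 x.2, (key ⟨z, LinearMap.mem_ker.2 hz⟩ x).1 hq⟩
  · obtain ⟨c, rfl⟩ := Submodule.Quotient.mk_surjective _ q
    obtain ⟨z, rfl⟩ := homologyClass2_surjective R c
    obtain ⟨x, hx, hxz⟩ := h z.1 z.2
    exact ⟨Submodule.Quotient.mk (homologyClass2 R A ⟨x, LinearMap.mem_ker.2 hx⟩),
      (key z ⟨x, LinearMap.mem_ker.2 hx⟩).2 hxz⟩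

end Interface

/-! ### Modules over the coefficient rings -/

section Coefficients

/-- The lifted rationals are the rationals. -/
noncomputable def carrierRatEquiv : CoeffRing.Carrier.{u} .rat ≃+* ℚ :=
  (ULift.ringEquiv : ULift.{u} ℚ ≃+* ℚ)

/-- The lifted integers modulo `p` are the integers modulo `p`. -/
noncomputable def carrierZModEquiv (p : ℕ) (hp : p.Prime) :
    CoeffRing.Carrier.{u} (.zmod p hp) ≃+* ZMod p :=
  (ULift.ringEquiv : ULift.{u} (ZMod p) ≃+* ZMod p)

/-- The lifted integers are the integers. -/
noncomputable def carrierIntEquiv : CoeffRing.Carrier.{u} .int ≃+* ℤ :=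
  (ULift.ringEquiv : ULift.{u} ℤ ≃+* ℤ)

theorem eq_zero_of_nsmul_eq_zero {T : Type*} [AddCommGroup T]
    [Module (CoeffRing.Carrier.{u} .rat) T] {k : ℕ} (hk : 0 < k) {t : T} (h : k • t = 0) :
    t = 0 := by
  have hu : IsUnit (k : CoeffRing.Carrier.{u} .rat) := by
    rw [← MulEquiv.isUnit_map carrierRatEquiv, map_natCast]
    exact (Nat.cast_ne_zero.2 hk.ne').isUnit
  rw [← Nat.cast_smul_eq_nsmul (CoeffRing.Carrier.{u} .rat)] at h
  exact (hu.smul_eq_zero).1 h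

theorem prime_nsmul_eq_zero {p : ℕ} {hp : p.Prime} {T : Type*} [AddCommGroup T]
    [Module (CoeffRing.Carrier.{u} (.zmod p hp)) T] (t : T) : p • t = 0 := by
  have h0 : (p : CoeffRing.Carrier.{u} (.zmod p hp)) = 0 := by
    apply (carrierZModEquiv p hp).injective
    rw [map_natCast, map_zero, ZMod.natCast_self]
  rw [← Nat.cast_smul_eq_nsmul (CoeffRing.Carrier.{u} (.zmod p hp)), h0, zero_smul]

end Coefficients

/-! ### Quotients by terms of the `R`-lower central series -/

section

variable {A : Type u} [Group A] (R : CoeffRing)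

/-- An `R`-module-valued function that is additive as soon as one of its arguments lies in `H`
vanishes on the successor of `H` in the `R`-lower central series. -/
theorem eq_zero_of_mem_rStep {H : Subgroup A} [H.Normal] (hle : rStep R H ≤ H) {T : Type*}
    [AddCommGroup T] [Module (CoeffRing.Carrier.{u} R) T] (τ : A → T)
    (hl : ∀ a b, a ∈ H → τ (a * b) = τ a + τ b) (hr : ∀ a b, b ∈ H → τ (a * b) = τ a + τ b)
    {x : A} (hx : x ∈ rStep R H) : τ x = 0 := by
  have h1 : τ 1 = 0 := by simpa using hl 1 1 H.one_mem
  let K : Subgroup A :=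
    { carrier := {x | x ∈ H ∧ τ x = 0}
      one_mem' := ⟨H.one_mem, h1⟩
      mul_mem' := fun {a b} ha hb => ⟨H.mul_mem ha.1 hb.1, by
        rw [hl _ _ ha.1, ha.2, hb.2, add_zero]⟩
      inv_mem' := fun {a} ha => ⟨H.inv_mem ha.1, by
        have := hl a a⁻¹ ha.1
        rwa [mul_inv_cancel, h1, ha.2, zero_add, eq_comm] at this⟩ }
  have hpow : ∀ a ∈ H, ∀ k : ℕ, τ (a ^ k) = k • τ a := by
    intro a ha k
    induction k with
    | zero => simpa using h1
    | succ k ih => rw [pow_succ, hr _ _ ha, ih, succ_nsmul]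
  have hcomm : ⁅(⊤ : Subgroup A), H⁆ ≤ K := by
    rw [Subgroup.commutator_le]
    intro g _ a ha
    rw [commutatorElement_def]
    have hc : g * a * g⁻¹ * a⁻¹ ∈ H := Subgroup.commutator_le_right ⊤ H
      (Subgroup.commutator_mem_commutator (Subgroup.mem_top g) ha)
    refine ⟨hc, ?_⟩
    have h2 : g * a * g⁻¹ * a⁻¹ * (a * g) = g * a := by group
    have h3 := hl _ (a * g) hc
    rw [h2, hr g a ha, hl a g ha, add_comm (τ g), right_eq_add] at h3
    exact h3
  suffices rStep R H ≤ K from (this hx).2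
  cases R with
  | int => exact hcomm
  | rat =>
    refine (Subgroup.closure_le _).2 fun y hy => ?_
    have hyH : y ∈ H := hle (Subgroup.subset_closure hy)
    obtain ⟨k, hk, hyk⟩ := hy
    refine ⟨hyH, eq_zero_of_nsmul_eq_zero hk ?_⟩
    rw [← hpow y hyH]
    exact (hcomm hyk).2
  | zmod p hp =>
    refine sup_le ((Subgroup.closure_le _).2 ?_) (by rwa [Subgroup.commutator_comm])
    rintro _ ⟨y, hy, rfl⟩
    exact ⟨H.pow_mem hy p, by rw [hpow y hy, prime_nsmul_eq_zero]⟩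

variable {R}

/-- A linear map out of `C₁(A; k)` that takes equal values on congruent group elements
kills the kernel of `C₁(A; k) → C₁(A / N; k)`. -/
theorem eq_zero_of_barMap1_mk_eq_zero {k : Type u} [CommRing k] {N : Subgroup A} [N.Normal]
    {T : Type*} [AddCommGroup T] [Module k T] (L : (A →₀ k) →ₗ[k] T)
    (hL : ∀ a, ∀ n ∈ N, L (Finsupp.single (a * n) 1) = L (Finsupp.single a 1)) {x : A →₀ k}
    (hx : barMap1 k (QuotientGroup.mk' N) x = 0) : L x = 0 := by
  let L' : (A ⧸ N →₀ k) →ₗ[k] T :=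
    Finsupp.linearCombination k fun q => L (Finsupp.single q.out 1)
  have h : L = L' ∘ₗ barMap1 k (QuotientGroup.mk' N) := by
    refine Finsupp.lhom_ext' fun a => LinearMap.ext_ring ?_
    obtain ⟨n, hn⟩ := QuotientGroup.mk_out_eq_mul N a
    simp only [LinearMap.comp_apply, Finsupp.lsingle_apply, barMap1_single, L',
      Finsupp.linearCombination_single, one_smul, QuotientGroup.mk'_apply]
    rw [hn, hL a n n.2]
  rw [h, LinearMap.comp_apply, hx, map_zero]

theorem barMap1_surjective {B : Type u} [Group B] {k : Type u} [CommRing k] {f : A →* B}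
    (hf : Function.Surjective f) : Function.Surjective (barMap1 k f) :=
  Finsupp.mapDomain_surjective hf

theorem barMap2_surjective {B : Type u} [Group B] {k : Type u} [CommRing k] {f : A →* B}
    (hf : Function.Surjective f) : Function.Surjective (barMap2 k f) :=
  Finsupp.mapDomain_surjective (hf.prodMap hf)

theorem rTerm_antitone : Antitone (rTerm A R) := antitone_nat_of_succ_le (rTerm_succ_le R)

theorem single_mk_one_mem_range_barD3 {k : Type u} [CommRing k] (g : A) :
    Finsupp.single (g, (1 : A)) (1 : k) - Finsupp.single (1, 1) 1 ∈
      LinearMap.range (barD3 A k) :=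
  ⟨-Finsupp.single (g, 1, 1) 1, by simp⟩

theorem single_one_mk_mem_range_barD3 {k : Type u} [CommRing k] (g : A) :
    Finsupp.single ((1 : A), g) (1 : k) - Finsupp.single (1, 1) 1 ∈
      LinearMap.range (barD3 A k) :=
  ⟨Finsupp.single (1, 1, g) 1, by simp⟩

/-- Projection to the quotient by a later term of the `R`-lower central series is an isomorphism
on `H₁(-; R)`. -/
theorem bijective_homologyMap_one_mk (n : ℕ) :
    Function.Bijective (homologyMap R (QuotientGroup.mk' (rTerm A R (n + 1))) 1) := by
  set k := CoeffRing.Carrier.{u} R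
  set f := QuotientGroup.mk' (rTerm A R (n + 1))
  have hf : Function.Surjective f := QuotientGroup.mk'_surjective _
  refine ⟨(injective_homologyMap_one_iff R _).2 fun x hx => ?_,
    (surjective_homologyMap_one_iff R _).2 fun y => ?_⟩
  · obtain ⟨w, hw⟩ := hx
    obtain ⟨v, rfl⟩ := barMap2_surjective (k := k) hf w
    rw [barD2_barMap2, ← sub_eq_zero, ← map_sub] at hw
    let L := (LinearMap.range (barD2 A k)).mkQ
    let τ : A → _ := fun a => L (Finsupp.single a 1)
    have hτ : ∀ a b, τ (a * b) = τ a + τ b := by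
      intro a b
      rw [← sub_eq_zero, ← map_add, ← map_sub]
      refine (Submodule.Quotient.mk_eq_zero _).2 ⟨-Finsupp.single (a, b) 1, ?_⟩
      rw [map_neg, barD2_single]
      abel
    have h0 : ∀ m ∈ rTerm A R (n + 1), τ m = 0 := fun m hm =>
      eq_zero_of_mem_rStep R (H := ⊤) le_top τ (fun a b _ => hτ a b) (fun a b _ => hτ a b)
        (rTerm_antitone (Nat.le_add_left 1 n) hm)
    have h := eq_zero_of_barMap1_mk_eq_zero L (fun a m hm => by
      change τ (a * m) = τ a
      rw [hτ, h0 m hm, add_zero]) hw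
    have h' := (Submodule.Quotient.mk_eq_zero _).1 h
    rw [← neg_mem_iff, neg_sub] at h'
    exact (sub_add_cancel x (barD2 A k v)) ▸ add_mem h' (LinearMap.mem_range_self (barD2 A k) v)
  · obtain ⟨x, rfl⟩ := barMap1_surjective (k := k) hf y
    exact ⟨x, by rw [sub_self]; exact zero_mem _⟩

/-- Projection to the quotient by the `(n+2)`-nd term of the `R`-lower central series belongs to
the Dwyer class of index `n + 1`: a cycle of the quotient lifts to a chain whose boundary can be
cancelled by the boundary of a chain that is trivial over `A / A_{n+1}`. -/
theorem dwyerClass_mk (n : ℕ) :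
    dwyerClass R (n + 1) _ _ (QuotientGroup.mk' (rTerm A R (n + 1))) := by
  refine ⟨bijective_homologyMap_one_mk n, (surjective_phiQuotientMap_iff R _ _).2 fun z hz => ?_⟩
  set k := CoeffRing.Carrier.{u} R
  set f := QuotientGroup.mk' (rTerm A R (n + 1))
  have hf : Function.Surjective f := QuotientGroup.mk'_surjective _
  let H := rTerm A R n
  let π := QuotientGroup.mk' H
  let U : Submodule k (A × A →₀ k) := (LinearMap.range (barD3 (A ⧸ H) k)).comap (barMap2 k π)
  let L := (U.map (barD2 A k)).mkQ
  let τ : A → _ := fun a => L (Finsupp.single a 1) - L (Finsupp.single 1 1)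
  have hτ : ∀ a b, (a ∈ H ∨ b ∈ H) → τ (a * b) = τ a + τ b := by
    intro a b hab
    have hu : Finsupp.single (a, b) (1 : k) - Finsupp.single (1, 1) 1 ∈ U := by
      rw [Submodule.mem_comap, map_sub, barMap2_single, barMap2_single]
      rcases hab with ha | hb
      · have : π a = 1 := (QuotientGroup.eq_one_iff a).2 ha
        simpa [this] using single_one_mk_mem_range_barD3 (k := k) (π b)
      · have : π b = 1 := (QuotientGroup.eq_one_iff b).2 hb
        simpa [this] using single_mk_one_mem_range_barD3 (k := k) (π a)
    have h := (Submodule.Quotient.mk_eq_zero _).2 (Submodule.mem_map_of_mem (f := barD2 A k) hu)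
    rw [← Submodule.mkQ_apply, map_sub, barD2_single, barD2_single] at h
    change L _ = 0 at h
    simp only [map_add, map_sub, mul_one] at h
    rw [← sub_eq_zero, ← neg_eq_zero, ← h]
    simp only [τ]
    abel
  have h0 : ∀ m ∈ rTerm A R (n + 1), τ m = 0 := fun m hm =>
    eq_zero_of_mem_rStep R (H := H) (rTerm_succ_le R n) τ (fun a b h => hτ a b (.inl h))
      (fun a b h => hτ a b (.inr h)) hm
  obtain ⟨y, rfl⟩ := barMap2_surjective (k := k) hf z
  rw [barD2_barMap2] at hz
  have h := eq_zero_of_barMap1_mk_eq_zero L (fun a m hm => by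
    have := hτ a m (.inr (rTerm_succ_le R n hm))
    rw [h0 m hm, add_zero] at this
    exact sub_left_injective this) hz
  obtain ⟨w, hwU, hw⟩ := (Submodule.Quotient.mk_eq_zero _).1 h
  refine ⟨y - w, by rw [map_sub, hw, sub_self], ?_⟩
  change barMap2 k (QuotientGroup.mk' (rTerm (A ⧸ rTerm A R (n + 1)) R n))
    (barMap2 k f y - barMap2 k f (y - w)) ∈
      LinearMap.range (barD3 ((A ⧸ rTerm A R (n + 1)) ⧸ rTerm (A ⧸ rTerm A R (n + 1)) R n) k)
  rw [← map_sub, sub_sub_cancel]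
  have hsq : (QuotientGroup.mk' (rTerm (A ⧸ rTerm A R (n + 1)) R n)).comp f =
      (QuotientGroup.map _ _ f (Subgroup.map_le_iff_le_comap.1 (map_rTerm_le R f n))).comp π := rfl
  rw [← barMap2_comp, hsq, barMap2_comp]
  exact barMap2_mem_range_barD3 _ hwU

theorem dwyerClass_id (n : ℕ) : dwyerClass R n A A (MonoidHom.id A) := by
  refine ⟨⟨(injective_homologyMap_one_iff R _).2 fun x hx => ?_,
    (surjective_homologyMap_one_iff R _).2 fun y => ⟨y, ?_⟩⟩,
    (surjective_phiQuotientMap_iff R _ _).2 fun z hz => ⟨z, hz, ?_⟩⟩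
  · simpa [barMap1] using hx
  · simp [barMap1]
  · simp [barMap2]

end

/-! ### Extending maps through central extensions -/

section Lifting

variable {R : CoeffRing} {A B E Q : Type u} [Group A] [Group B] [Group E] [Group Q]

/-- A linear map vanishing on the kernel of a surjective linear map factors through it. -/
theorem exists_comp_eq_of_ker_le {k V W X : Type*} [CommRing k] [AddCommGroup V] [AddCommGroup W]
    [AddCommGroup X] [Module k V] [Module k W] [Module k X] {Θ : V →ₗ[k] W}
    (hΘ : Function.Surjective Θ) {Λ : V →ₗ[k] X} (h : LinearMap.ker Θ ≤ LinearMap.ker Λ) :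
    ∃ l : W →ₗ[k] X, ∀ v, l (Θ v) = Λ v := by
  refine ⟨(LinearMap.ker Θ).liftQ Λ h ∘ₗ (Θ.quotKerEquivOfSurjective hΘ).symm.toLinearMap,
    fun v => ?_⟩
  have : (Θ.quotKerEquivOfSurjective hΘ).symm (Θ v) = Submodule.Quotient.mk v := by
    rw [LinearEquiv.symm_apply_eq]
    rfl
  simp [this]

/-- **Lifting along a central extension.** Let `E → Q` be a central extension by an `R`-module `M`
and `f : A → B` a map in the Dwyer class. If `ψ : B → Q` kills `B^R_{n+1}` and `ψ ∘ f` lifts to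
`φ : A → E`, then `φ` extends along `f` to `B`.

A set-theoretic section of `E → Q` gives a cocycle `g` on `C₂(B)`, and `φ` trivializes its
restriction to `A` by a map `T` on `C₁(A)`. The condition on `H₂` makes `g` vanish on `Z₂(B)`, and
the condition on `H₁` says that `C₁(B) = f_* C₁(A) + B₁(B)` with `f_*⁻¹ B₁(B) = B₁(A)`, so that `T` and
`-g` glue to a trivialization of `g` on `C₁(B)`. -/
theorem exists_extension_of_central {n : ℕ} {f : A →* B} (hf : dwyerClass R (n + 1) A B f)
    {π : E →* Q} (hπ : Function.Surjective π) {M : Type u} [AddCommGroup M]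
    [Module (CoeffRing.Carrier.{u} R) M] {ι : Multiplicative M →* E}
    (hι : Function.Injective ι) (hker : ι.range = π.ker) (hcent : ∀ m e, ι m * e = e * ι m)
    (φ : A →* E) (ψ : B →* Q) (hψ : rTerm B R n ≤ ψ.ker) (hφψ : ψ.comp f = π.comp φ) :
    ∃ ψ' : B →* E, ψ'.comp f = φ := by
  obtain ⟨⟨h1i, h1s⟩, h2⟩ := hf
  rw [injective_homologyMap_one_iff] at h1i
  rw [surjective_homologyMap_one_iff] at h1s
  rw [surjective_phiQuotientMap_iff] at h2
  set k := CoeffRing.Carrier.{u} R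
  let i : M → E := fun m => ι (Multiplicative.ofAdd m)
  have hi_add : ∀ m m', i (m + m') = i m * i m' := fun m m' => by simp [i]
  have hi_inj : ∀ {m m'}, i m = i m' → m = m' := fun h => Multiplicative.ofAdd.injective (hι h)
  have hi_c : ∀ m e, i m * e = e * i m := fun m e => hcent _ e
  have hi_ker : ∀ {e}, π e = 1 → ∃ m, i m = e := fun {e} he => by
    obtain ⟨m, hm⟩ := hker.ge (MonoidHom.mem_ker.2 he)
    exact ⟨m.toAdd, hm⟩
  let s := Function.surjInv hπ
  have hs : ∀ q, π (s q) = q := Function.surjInv_eq hπ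
  -- the cocycle `c` of the section `s`, with values in `M`
  have hc : ∀ q : Q × Q, ∃ m, i m = s q.1 * s q.2 * (s (q.1 * q.2))⁻¹ := fun q =>
    hi_ker (by simp [hs])
  choose c hc using hc
  have hc' : ∀ q q', s q * s q' = i (c (q, q')) * s (q * q') := fun q q' => by simp [hc]
  have hcoc : ∀ q₁ q₂ q₃, c (q₁, q₂) + c (q₁ * q₂, q₃) = c (q₂, q₃) + c (q₁, q₂ * q₃) := by
    intro q₁ q₂ q₃
    apply hi_inj
    apply mul_right_cancel (b := s (q₁ * q₂ * q₃))
    rw [hi_add, hi_add, mul_assoc, ← hc', ← mul_assoc, ← hc', mul_assoc, mul_assoc, mul_assoc,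
      ← hc', hc' q₂, ← mul_assoc, ← hi_c, mul_assoc]
  let gQ : (Q × Q →₀ k) →ₗ[k] M := Finsupp.linearCombination k c
  have hgQ : ∀ x ∈ LinearMap.range (barD3 Q k), gQ x = 0 := by
    rintro _ ⟨x, rfl⟩
    have : gQ ∘ₗ barD3 Q k = 0 := by
      refine Finsupp.lhom_ext' fun a => LinearMap.ext_ring ?_
      simp only [LinearMap.comp_apply, Finsupp.lsingle_apply, barD3_single, map_sub, map_add, gQ,
        Finsupp.linearCombination_single, one_smul, LinearMap.zero_apply]
      rw [sub_add, sub_sub, sub_eq_zero, eq_comm, sub_add_eq_add_sub, sub_eq_iff_eq_add,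
        add_comm (c (a.1 * a.2.1, a.2.2)), hcoc]
    exact LinearMap.congr_fun this x
  let g : (B × B →₀ k) →ₗ[k] M := gQ ∘ₗ barMap2 k ψ
  have hg1 : ∀ b b', g (Finsupp.single (b, b') 1) = c (ψ b, ψ b') := by simp [g, gQ]
  -- comparing `φ` with the section along `ψ ∘ f` trivializes the cocycle on `A`
  have ht : ∀ a, ∃ m, i m = φ a * (s (ψ (f a)))⁻¹ := fun a =>
    hi_ker (by
      have := DFunLike.congr_fun hφψ a
      simp only [MonoidHom.comp_apply] at this
      simp [hs, this])
  choose t ht using ht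
  have ht' : ∀ a, φ a = i (t a) * s (ψ (f a)) := fun a => by simp [ht]
  let T : (A →₀ k) →ₗ[k] M := Finsupp.linearCombination k t
  have hT : ∀ x, T (barD2 A k x) = - g (barMap2 k f x) := by
    intro x
    have : T ∘ₗ barD2 A k = -(g ∘ₗ barMap2 k f) := by
      refine Finsupp.lhom_ext' fun a => LinearMap.ext_ring ?_
      simp only [LinearMap.comp_apply, Finsupp.lsingle_apply, barD2_single, map_sub, map_add, T,
        Finsupp.linearCombination_single, one_smul, LinearMap.neg_apply, barMap2_single, hg1]
      have : t (a.1 * a.2) = t a.1 + t a.2 + c (ψ (f a.1), ψ (f a.2)) := by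
        apply hi_inj
        apply mul_right_cancel (b := s (ψ (f (a.1 * a.2))))
        rw [← ht', map_mul, ht' a.1, ht' a.2, hi_add, hi_add, map_mul f, map_mul ψ,
          mul_assoc _ (i (c _)), ← hc', mul_assoc, mul_assoc, ← mul_assoc (s _) (i _), ← hi_c,
          mul_assoc]
      rw [this]
      abel
    exact LinearMap.congr_fun this x
  have hgz : ∀ z, barD2 B k z = 0 → g z = 0 := by
    intro z hz
    obtain ⟨x, hx, hxz⟩ := h2 z hz
    have hψl : ψ = (QuotientGroup.lift _ ψ hψ).comp (QuotientGroup.mk' (rTerm B R n)) := rfl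
    have h0 : g (z - barMap2 k f x) = 0 := by
      change gQ (barMap2 k ψ _) = 0
      rw [hψl, barMap2_comp]
      exact hgQ _ (barMap2_mem_range_barD3 _ hxz)
    have hgx : g (barMap2 k f x) = 0 := by rw [← neg_eq_zero, ← hT, hx, map_zero]
    rwa [map_sub, hgx, sub_zero] at h0
  -- `Λ` descends along `Θ` to the trivialization on `B`
  let Θ : ((A →₀ k) × (B × B →₀ k)) →ₗ[k] (B →₀ k) := (barMap1 k f).coprod (barD2 B k)
  let Λ : ((A →₀ k) × (B × B →₀ k)) →ₗ[k] M := T.coprod (-g)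
  have hΘ : Function.Surjective Θ := by
    intro y
    obtain ⟨x, w, hw⟩ := h1s y
    refine ⟨(x, w), ?_⟩
    change barMap1 k f x + barD2 B k w = y
    rw [hw, add_sub_cancel]
  have hΛ : LinearMap.ker Θ ≤ LinearMap.ker Λ := by
    rintro ⟨x, w⟩ hxw
    simp only [LinearMap.mem_ker, Θ, Λ, LinearMap.coprod_apply, LinearMap.neg_apply] at hxw ⊢
    obtain ⟨v, rfl⟩ := h1i x ⟨-w, by rw [map_neg]; exact (eq_neg_of_add_eq_zero_left hxw).symm⟩
    rw [hT, ← neg_add, ← map_add, hgz, neg_zero]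
    rw [map_add, barD2_barMap2, hxw]
  obtain ⟨h, hh⟩ := exists_comp_eq_of_ker_le hΘ hΛ
  have hhd : ∀ w, h (barD2 B k w) = -g w := fun w => by
    have := hh (0, w)
    simpa [Θ, Λ] using this
  have hhf : ∀ x, h (barMap1 k f x) = T x := fun x => by
    have := hh (x, 0)
    simpa [Θ, Λ] using this
  have hmul : ∀ b b', h (Finsupp.single (b * b') 1) =
      h (Finsupp.single b 1) + h (Finsupp.single b' 1) + c (ψ b, ψ b') := by
    intro b b'
    have := hhd (Finsupp.single (b, b') 1)
    rw [barD2_single, hg1, map_add, map_sub] at this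
    rw [← sub_eq_zero, ← neg_eq_zero, ← sub_eq_zero.2 this]
    abel
  refine ⟨MonoidHom.mk' (fun b => i (h (Finsupp.single b 1)) * s (ψ b)) fun b b' => ?_, ?_⟩
  · rw [hmul, hi_add, hi_add, map_mul ψ, mul_assoc _ (i (c _)), ← hc', mul_assoc, mul_assoc,
      ← mul_assoc (s _) (i _), ← hi_c, mul_assoc]
  · ext a
    have := hhf (Finsupp.single a 1)
    rw [barMap1_single] at this
    rw [ht']
    simp [this, T]

end Lifting

/-! ### Towers of central extensions -/

section Tower

variable (R : CoeffRing)

/-- `IsTower R n G`: the group `G` is obtained from the trivial group by `n` successive central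
extensions by `R`-modules. -/
def IsTower : ℕ → ∀ (G : Type u) [Group G], Prop
  | 0, G, _ => Subsingleton G
  | n + 1, G, _ => ∃ (Q : Type u) (_ : Group Q) (π : G →* Q) (M : Type u) (_ : AddCommGroup M)
      (_ : Module (CoeffRing.Carrier.{u} R) M) (ι : Multiplicative M →* G),
      Function.Surjective π ∧ Function.Injective ι ∧ ι.range = π.ker ∧
        (∀ m e, ι m * e = e * ι m) ∧ IsTower n Q

variable {R}

theorem IsTower.rTerm_eq_bot {n : ℕ} {G : Type u} [Group G] (h : IsTower R n G) :
    rTerm G R n = ⊥ := by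
  induction n generalizing G with
  | zero =>
    have : Subsingleton G := h
    exact Subsingleton.elim _ _
  | succ n ih =>
    obtain ⟨Q, _, π, M, _, _, ι, -, hι, hker, hcent, hQ⟩ := h
    have hle : rTerm G R n ≤ ι.range := by
      rw [hker, ← MonoidHom.comap_bot, ← Subgroup.map_le_iff_le_comap, ← ih hQ]
      exact map_rTerm_le R π n
    have hc : ⁅(⊤ : Subgroup G), rTerm G R n⁆ = ⊥ := by
      rw [Subgroup.commutator_comm, Subgroup.commutator_eq_bot_iff_le_centralizer]
      intro x hx
      obtain ⟨m, rfl⟩ := hle hx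
      exact Subgroup.mem_centralizer_iff.2 fun e _ => (hcent m e).symm
    rw [eq_bot_iff]
    cases R with
    | int => exact hc.le
    | rat =>
      refine (Subgroup.closure_le _).2 fun x hx => ?_
      obtain ⟨m, rfl⟩ := hle (rTerm_succ_le _ n (Subgroup.subset_closure hx))
      obtain ⟨k, hk, hx⟩ := hx
      rw [hc, Subgroup.mem_bot, ← map_pow, map_eq_one_iff ι hι] at hx
      have : m.toAdd = 0 := eq_zero_of_nsmul_eq_zero hk (by rw [← toAdd_pow, hx]; rfl)
      have hm : m = 1 := Multiplicative.toAdd.injective this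
      simp [hm]
    | zmod p hp =>
      refine sup_le ((Subgroup.closure_le _).2 ?_) (by rw [Subgroup.commutator_comm]; exact hc.le)
      rintro _ ⟨y, hy, rfl⟩
      obtain ⟨m, rfl⟩ := hle hy
      have hm : m ^ p = 1 := Multiplicative.toAdd.injective (prime_nsmul_eq_zero m.toAdd)
      rw [← map_pow, hm, map_one]
      exact one_mem _

/-- Every map from `A` to a tower of height `n` extends along maps `A → B` in the `n`-th Dwyer
class. -/
theorem IsTower.exists_extension {n m : ℕ} (hm : m ≤ n) {A B G : Type u} [Group A] [Group B]
    [Group G] {f : A →* B} (hf : dwyerClass R n A B f) (h : IsTower R m G) (φ : A →* G) :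
    ∃ ψ : B →* G, ψ.comp f = φ := by
  induction m generalizing G with
  | zero =>
    have : Subsingleton G := h
    exact ⟨1, by ext; exact Subsingleton.elim _ _⟩
  | succ m ih =>
    obtain ⟨Q, _, π, M, _, _, ι, hπ, hι, hker, hcent, hQ⟩ := h
    obtain ⟨ψ, hψ⟩ := ih (by omega) hQ (π.comp φ)
    obtain ⟨n, rfl⟩ : ∃ n', n = n' + 1 := ⟨n - 1, by omega⟩
    refine exists_extension_of_central hf hπ hι hker hcent φ ψ ?_ hψ
    refine (rTerm_antitone (show m ≤ n by omega)).trans ?_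
    rw [← MonoidHom.comap_bot, ← Subgroup.map_le_iff_le_comap, ← hQ.rTerm_eq_bot]
    exact map_rTerm_le R ψ m

/-- If `A` maps to a tower of height `n` by a map with kernel inside `A^R_{n+1}`, then maps in the
`n`-th Dwyer class reflect membership in the `R`-lower central series. -/
theorem IsTower.mem_rTerm_of_map_mem {n : ℕ} {A B G : Type u} [Group A] [Group B] [Group G]
    (h : IsTower R n G) {φ : A →* G} (hφ : φ.ker ≤ rTerm A R n) {f : A →* B}
    (hf : dwyerClass R n A B f) {a : A} (ha : f a ∈ rTerm B R n) : a ∈ rTerm A R n := by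
  obtain ⟨ψ, rfl⟩ := h.exists_extension le_rfl hf φ
  apply hφ
  have := map_rTerm_le R ψ n (Subgroup.mem_map_of_mem ψ ha)
  rwa [h.rTerm_eq_bot] at this

open scoped IsMulCommutative in
theorem isTower_succ_of_ker_le_center {n : ℕ} {E Q : Type u} [Group E] [Group Q] {π : E →* Q}
    (hπ : Function.Surjective π) (hc : π.ker ≤ Subgroup.center E) (hQ : IsTower R n Q)
    [IsMulCommutative π.ker] (hM : Nonempty (Module (CoeffRing.Carrier.{u} R) (Additive π.ker))) :
    IsTower R (n + 1) E := by
  obtain ⟨_⟩ := hM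
  refine ⟨Q, _, π, Additive π.ker, inferInstance, inferInstance,
    π.ker.subtype.comp (MulEquiv.multiplicativeAdditive _).toMonoidHom, hπ, ?_, ?_, ?_, hQ⟩
  · exact Subtype.val_injective.comp (MulEquiv.injective _)
  · ext x
    constructor
    · rintro ⟨m, rfl⟩
      exact (m.toAdd.toMul).2
    · intro hx
      exact ⟨Multiplicative.ofAdd (Additive.ofMul ⟨x, hx⟩), rfl⟩
  · intro m e
    exact (Subgroup.mem_center_iff.1 (hc (m.toAdd.toMul).2) e).symm

open scoped IsMulCommutative in
/-- For `R = ℤ` and `R = ℤ/p` the quotient `A / A^R_{n+1}` is itself a tower of height `n`. -/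
theorem isTower_quotient (hR : R ≠ .rat) (n : ℕ) (A : Type u) [Group A] :
    IsTower R n (A ⧸ rTerm A R n) := by
  induction n with
  | zero => exact QuotientGroup.subsingleton_quotient_top
  | succ n ih =>
    let π : A ⧸ rTerm A R (n + 1) →* A ⧸ rTerm A R n :=
      QuotientGroup.map _ _ (MonoidHom.id A) (rTerm_succ_le R n)
    have hπ : Function.Surjective π := fun q => by
      obtain ⟨a, rfl⟩ := QuotientGroup.mk_surjective q
      exact ⟨a, rfl⟩
    have hker : ∀ x ∈ π.ker, ∃ a ∈ rTerm A R n, (a : A ⧸ rTerm A R (n + 1)) = x := by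
      intro x hx
      obtain ⟨a, rfl⟩ := QuotientGroup.mk_surjective x
      exact ⟨a, (QuotientGroup.eq_one_iff a).1 hx, rfl⟩
    have hcle : ⁅rTerm A R n, (⊤ : Subgroup A)⁆ ≤ rTerm A R (n + 1) := by
      cases R with
      | int => exact (Subgroup.commutator_comm _ _).le
      | rat => exact absurd rfl hR
      | zmod p hp => exact le_sup_right
    have hc : π.ker ≤ Subgroup.center _ := by
      intro x hx
      obtain ⟨a, ha, rfl⟩ := hker x hx
      refine Subgroup.mem_center_iff.2 fun y => ?_
      obtain ⟨b, rfl⟩ := QuotientGroup.mk_surjective y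
      rw [← QuotientGroup.mk_mul, ← QuotientGroup.mk_mul, QuotientGroup.eq]
      have := hcle (Subgroup.commutator_mem_commutator (inv_mem ha) (Subgroup.mem_top b⁻¹))
      simpa [commutatorElement_def, mul_assoc] using this
    have : IsMulCommutative π.ker :=
      ⟨⟨fun x y => Subtype.ext (Subgroup.mem_center_iff.1 (hc y.2) x)⟩⟩
    refine isTower_succ_of_ker_le_center hπ hc ih ?_
    cases R with
    | int => exact ⟨Module.compHom (Additive π.ker) carrierIntEquiv.toRingHom⟩
    | rat => exact absurd rfl hR
    | zmod p hp =>
      let _ : Module (ZMod p) (Additive π.ker) :=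
        AddCommGroup.zmodModule fun x => by
          obtain ⟨a, ha, hax⟩ := hker _ x.toMul.2
          refine Additive.toMul.injective (Subtype.ext ?_)
          change (x.toMul.1 : A ⧸ rTerm A (.zmod p hp) (n + 1)) ^ p = 1
          have hp' : a ^ p ∈ rTerm A (.zmod p hp) (n + 1) :=
            Subgroup.mem_sup_left (Subgroup.subset_closure ⟨a, ha, rfl⟩)
          exact (congrArg (· ^ p) hax.symm).trans ((QuotientGroup.eq_one_iff _).2 hp')
      exact ⟨Module.compHom (Additive π.ker) (carrierZModEquiv p hp).toRingHom⟩

end Tower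

/-! ### The rational lower central series is an `N`-series -/

section RationalSeries

variable {A : Type u} [Group A]

theorem mem_rTerm_rat_of_pow_mem {n k : ℕ} (hk : 0 < k) {x : A} (hx : x ^ k ∈ rTerm A .rat n) :
    x ∈ rTerm A .rat n := by
  cases n with
  | zero => trivial
  | succ n =>
    rw [mem_rTerm_rat_succ] at hx ⊢
    obtain ⟨l, hl, h⟩ := hx
    exact ⟨k * l, Nat.mul_pos hk hl, by rwa [pow_mul]⟩

theorem commutator_top_rTerm_rat_le (n : ℕ) :
    ⁅(⊤ : Subgroup A), rTerm A .rat n⁆ ≤ rTerm A .rat (n + 1) :=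
  fun x hx => Subgroup.subset_closure ⟨1, one_pos, by rwa [pow_one]⟩

/-- The three subgroups lemma modulo a normal subgroup. -/
theorem commutator_commutator_le_of_rotate {H₁ H₂ H₃ N : Subgroup A} [N.Normal]
    (h1 : ⁅⁅H₂, H₃⁆, H₁⁆ ≤ N) (h2 : ⁅⁅H₃, H₁⁆, H₂⁆ ≤ N) : ⁅⁅H₁, H₂⁆, H₃⁆ ≤ N := by
  rw [← QuotientGroup.ker_mk' N, ← MonoidHom.comap_bot, ← Subgroup.map_le_iff_le_comap, le_bot_iff,
    Subgroup.map_commutator, Subgroup.map_commutator] at h1 h2 ⊢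
  exact Subgroup.commutator_commutator_eq_bot_of_rotate h1 h2

/-- The rational lower central series is an `N`-series. Raising the first index, `x ^ k` is a
product of commutators for some `k > 0`; modulo the target term `[x, y]` is central, so that
`[x ^ k, y] = [x, y] ^ k`, and the target term is closed under roots. -/
theorem commutator_rTerm_rat_le (i j : ℕ) :
    ⁅rTerm A .rat i, rTerm A .rat j⁆ ≤ rTerm A .rat (i + j + 1) := by
  induction i generalizing j with
  | zero => rw [zero_add]; exact commutator_top_rTerm_rat_le j
  | succ i ih =>
    set N := rTerm A .rat (i + 1 + j + 1) with hN
    have h3 : ⁅⁅(⊤ : Subgroup A), rTerm A .rat i⁆, rTerm A .rat j⁆ ≤ N := by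
      apply commutator_commutator_le_of_rotate
      · refine (Subgroup.commutator_mono (ih j) le_rfl).trans ?_
        rw [Subgroup.commutator_comm, hN, show i + 1 + j + 1 = i + j + 1 + 1 by omega]
        exact commutator_top_rTerm_rat_le _
      · rw [Subgroup.commutator_comm]
        refine (Subgroup.commutator_mono le_rfl ?_).trans
          ((ih (j + 1)).trans_eq (by rw [hN, show i + 1 + j + 1 = i + (j + 1) + 1 by omega]))
        rw [Subgroup.commutator_comm]
        exact commutator_top_rTerm_rat_le j
    rw [Subgroup.commutator_le]
    intro x hx y hy
    have hc := ih j (Subgroup.commutator_mem_commutator (rTerm_succ_le .rat i hx) hy)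
    obtain ⟨k, hk, hxk⟩ := (mem_rTerm_rat_succ i x).1 hx
    apply mem_rTerm_rat_of_pow_mem hk
    have hxky := h3 (Subgroup.commutator_mem_commutator hxk hy)
    have hcx := commutator_top_rTerm_rat_le _ (Subgroup.commutator_mem_commutator
      (Subgroup.mem_top x) hc)
    rw [show i + j + 1 + 1 = i + 1 + j + 1 by omega] at hcx
    rw [← QuotientGroup.eq_one_iff] at hcx hxky ⊢
    simp only [commutatorElement_def, QuotientGroup.mk_mul, QuotientGroup.mk_inv,
      QuotientGroup.mk_pow] at hcx hxky ⊢
    generalize (x : A ⧸ N) = x at *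
    generalize (y : A ⧸ N) = y at *
    have hcomm : x * (x * y * x⁻¹ * y⁻¹) = (x * y * x⁻¹ * y⁻¹) * x := by
      rw [mul_inv_eq_one, mul_inv_eq_iff_eq_mul] at hcx
      exact hcx
    have hpow : ∀ m : ℕ, x ^ m * y * (x ^ m)⁻¹ = (x * y * x⁻¹ * y⁻¹) ^ m * y := by
      intro m
      induction m with
      | zero => simp
      | succ m ihm =>
        have h1 : x ^ (m + 1) * y * (x ^ (m + 1))⁻¹ = x * (x ^ m * y * (x ^ m)⁻¹) * x⁻¹ := by
          rw [pow_succ']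
          group
        rw [h1, ihm, ← mul_assoc, ((show Commute x (x * y * x⁻¹ * y⁻¹) from hcomm).pow_right m).eq,
          pow_succ]
        group
    rwa [hpow, mul_inv_cancel_right] at hxky

end RationalSeries

/-! ### The weight filtration of the rational group algebra -/

section GroupAlgebra

variable {A : Type u} [Group A]

/-- The linear extension to `ℚ[A]` of a function on `A`. -/
noncomputable def linExtend {M : Type*} [AddCommGroup M] [Module ℚ M] (v : A → M) :
    MonoidAlgebra ℚ A →ₗ[ℚ] M :=
  (MonoidAlgebra.basis A ℚ).constr ℚ v

@[simp]
theorem linExtend_of {M : Type*} [AddCommGroup M] [Module ℚ M] (v : A → M) (a : A) :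
    linExtend v (of ℚ A a) = v a := by
  have h : of ℚ A a = MonoidAlgebra.basis A ℚ a := by simp
  rw [h, linExtend, Module.Basis.constr_basis]

variable (A) in
/-- A descending series of subgroups `A = F 0 = F 1 ≥ F 2 ≥ ⋯` with `[F i, F j] ≤ F (i + j)`, each
closed under taking roots. -/
structure IsRootClosedNSeries (F : ℕ → Subgroup A) : Prop where
  zero : F 0 = ⊤
  one : F 1 = ⊤
  antitone : Antitone F
  commutator_le : ∀ i j, ⁅F i, F j⁆ ≤ F (i + j)
  root_mem : ∀ {i k : ℕ} {x : A}, 0 < k → x ^ k ∈ F i → x ∈ F i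

/-- Products `(g₁ - 1) ⋯ (gₛ - 1)` with `gⱼ ∈ H ∩ F iⱼ`, of weight at least `k`, i.e.
`i₁ + ⋯ + iₛ ≥ k`. -/
inductive WeightedProduct (F : ℕ → Subgroup A) (H : Subgroup A) : ℕ → MonoidAlgebra ℚ A → Prop
  | one : WeightedProduct F H 0 1
  | mul {i k l : ℕ} {g : A} {x : MonoidAlgebra ℚ A} (hg : g ∈ H) (hgi : g ∈ F i)
      (hx : WeightedProduct F H k x) (hl : l ≤ i + k) :
      WeightedProduct F H l ((of ℚ A g - 1) * x)

/-- The weight filtration of the group algebra `ℚ[H]`, inside `ℚ[A]`: the span of the products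
`(g₁ - 1) ⋯ (gₛ - 1)` of weight at least `k`, with factors from `H`. -/
noncomputable def weightFilt (F : ℕ → Subgroup A) (H : Subgroup A) (k : ℕ) :
    Submodule ℚ (MonoidAlgebra ℚ A) :=
  Submodule.span ℚ {x | WeightedProduct F H k x}

/-- The group algebra of a subgroup `H`, inside `ℚ[A]`. -/
noncomputable def subAlg (H : Subgroup A) : Submodule ℚ (MonoidAlgebra ℚ A) :=
  Submodule.span ℚ (of ℚ A '' H)

variable {F : ℕ → Subgroup A} {H N : Subgroup A}

theorem WeightedProduct.anti {k l : ℕ} {x : MonoidAlgebra ℚ A} (hx : WeightedProduct F H k x)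
    (hlk : l ≤ k) : WeightedProduct F H l x := by
  cases hx with
  | one => obtain rfl := Nat.le_zero.1 hlk; exact .one
  | mul hg hgi hx hl => exact .mul hg hgi hx (hlk.trans hl)

theorem weightFilt_antitone : Antitone (weightFilt F H) := fun _ _ h =>
  Submodule.span_mono fun _ hx => hx.anti h

theorem sub_one_mul_mem_weightFilt {i k : ℕ} {g : A} (hg : g ∈ H) (hgi : g ∈ F i)
    {x : MonoidAlgebra ℚ A} (hx : x ∈ weightFilt F H k) :
    (of ℚ A g - 1) * x ∈ weightFilt F H (i + k) := by
  induction hx using Submodule.span_induction with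
  | mem x hx => exact Submodule.subset_span (.mul hg hgi hx le_rfl)
  | zero => rw [mul_zero]; exact zero_mem _
  | add x y _ _ hx hy => rw [mul_add]; exact add_mem hx hy
  | smul r x _ hx => rw [mul_smul_comm]; exact Submodule.smul_mem _ _ hx

theorem of_mul_mem_weightFilt (hF0 : F 0 = ⊤) {k : ℕ} {g : A} (hg : g ∈ H)
    {x : MonoidAlgebra ℚ A} (hx : x ∈ weightFilt F H k) :
    of ℚ A g * x ∈ weightFilt F H k := by
  have h := sub_one_mul_mem_weightFilt (i := 0) hg (by rw [hF0]; trivial) hx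
  rw [zero_add] at h
  have := add_mem h hx
  rwa [sub_mul, one_mul, sub_add_cancel] at this

theorem one_mem_weightFilt : (1 : MonoidAlgebra ℚ A) ∈ weightFilt F H 0 :=
  Submodule.subset_span .one

theorem sub_one_mem_weightFilt {i : ℕ} {g : A} (hg : g ∈ H) (hgi : g ∈ F i) :
    of ℚ A g - 1 ∈ weightFilt F H i := by
  simpa using sub_one_mul_mem_weightFilt hg hgi one_mem_weightFilt

theorem of_mul_mem_subAlg {g : A} (hg : g ∈ H) {x : MonoidAlgebra ℚ A} (hx : x ∈ subAlg H) :
    of ℚ A g * x ∈ subAlg H := by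
  induction hx using Submodule.span_induction with
  | mem x hx =>
    obtain ⟨h, hh, rfl⟩ := hx
    rw [← map_mul]
    exact Submodule.subset_span ⟨_, H.mul_mem hg hh, rfl⟩
  | zero => rw [mul_zero]; exact zero_mem _
  | add x y _ _ hx hy => rw [mul_add]; exact add_mem hx hy
  | smul r x _ hx => rw [mul_smul_comm]; exact Submodule.smul_mem _ _ hx

theorem WeightedProduct.mem_subAlg {k : ℕ} {x : MonoidAlgebra ℚ A}
    (hx : WeightedProduct F H k x) : x ∈ subAlg H := by
  induction hx with
  | one => exact Submodule.subset_span ⟨1, H.one_mem, map_one _⟩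
  | mul hg _ _ _ ih =>
    rw [sub_mul, one_mul]
    exact sub_mem (of_mul_mem_subAlg hg ih) ih

/-- An element of the weight filtration only involves finitely many elements of the subgroup. -/
theorem exists_finite_of_mem_weightFilt {k : ℕ} {x : MonoidAlgebra ℚ A}
    (hx : x ∈ weightFilt F H k) :
    ∃ S : Set A, S.Finite ∧ S ⊆ H ∧ ∀ H' : Subgroup A, S ⊆ H' → x ∈ weightFilt F H' k := by
  induction hx using Submodule.span_induction with
  | mem x hx =>
    suffices ∃ S : Set A, S.Finite ∧ S ⊆ H ∧
        ∀ H' : Subgroup A, S ⊆ H' → WeightedProduct F H' k x by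
      obtain ⟨S, h1, h2, h3⟩ := this
      exact ⟨S, h1, h2, fun H' hH' => Submodule.subset_span (h3 H' hH')⟩
    induction hx with
    | one => exact ⟨∅, Set.finite_empty, Set.empty_subset _, fun _ _ => .one⟩
    | @mul i k l g x hg hgi _ hl ih =>
      obtain ⟨S, h1, h2, h3⟩ := ih
      exact ⟨insert g S, h1.insert g, Set.insert_subset hg h2, fun H' hH' =>
        .mul (hH' (Set.mem_insert _ _)) hgi (h3 H' ((Set.subset_insert _ _).trans hH')) hl⟩
  | zero => exact ⟨∅, Set.finite_empty, Set.empty_subset _, fun _ _ => zero_mem _⟩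
  | add x y _ _ hx hy =>
    obtain ⟨S, h1, h2, h3⟩ := hx
    obtain ⟨S', h1', h2', h3'⟩ := hy
    exact ⟨S ∪ S', h1.union h1', Set.union_subset h2 h2', fun H' hH' =>
      add_mem (h3 H' (Set.subset_union_left.trans hH')) (h3' H' (Set.subset_union_right.trans hH'))⟩
  | smul r x _ hx =>
    obtain ⟨S, h1, h2, h3⟩ := hx
    exact ⟨S, h1, h2, fun H' hH' => Submodule.smul_mem _ _ (h3 H' hH')⟩

/-- Conjugation by an element of weight `w ≥ 1` is unipotent for the weight filtration:
it moves each element of weight `j` by an element of weight `j + w`. -/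
theorem conj_sub_mem_weightFilt (hF : IsRootClosedNSeries A F) {w : ℕ} (hw : 1 ≤ w)
    (hwN : F (w + 1) ≤ N) (hN : N ≤ F w) {y : A} (hy : y ∈ F w) {j : ℕ} {v : MonoidAlgebra ℚ A}
    (hv : v ∈ weightFilt F N j) :
    of ℚ A y * v * of ℚ A y⁻¹ - v ∈ weightFilt F N (j + w) := by
  have hyy : of ℚ A y⁻¹ * of ℚ A y = 1 := by rw [← map_mul, inv_mul_cancel, map_one]
  have hyy' : of ℚ A y * of ℚ A y⁻¹ = 1 := by rw [← map_mul, mul_inv_cancel, map_one]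
  induction hv using Submodule.span_induction with
  | mem v hv =>
    induction hv with
    | one => rw [mul_one, hyy', sub_self]; exact zero_mem _
    | @mul i k l g v hg hgi hv hl ih =>
      have hcN : y * g * y⁻¹ * g⁻¹ ∈ N := hwN (hF.antitone (by omega)
        (hF.commutator_le w w (Subgroup.commutator_mem_commutator hy (hN hg))))
      have hci : y * g * y⁻¹ * g⁻¹ ∈ F (w + i) :=
        hF.commutator_le w i (Subgroup.commutator_mem_commutator hy hgi)
      have hcv : of ℚ A y * v * of ℚ A y⁻¹ ∈ weightFilt F N k := by
        have := add_mem (weightFilt_antitone (Nat.le_add_right k w) ih)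
          (Submodule.subset_span hv : v ∈ weightFilt F N k)
        rwa [sub_add_cancel] at this
      have h1 : of ℚ A y * ((of ℚ A g - 1) * v) * of ℚ A y⁻¹ - (of ℚ A g - 1) * v =
          (of ℚ A (y * g * y⁻¹ * g⁻¹) - 1) * (of ℚ A g * (of ℚ A y * v * of ℚ A y⁻¹)) +
            (of ℚ A g - 1) * (of ℚ A y * v * of ℚ A y⁻¹ - v) := by
        have h2 : of ℚ A (y * g * y⁻¹ * g⁻¹) * (of ℚ A g * (of ℚ A y * v * of ℚ A y⁻¹)) =
            of ℚ A y * (of ℚ A g * v) * of ℚ A y⁻¹ := by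
          simp only [← mul_assoc, ← map_mul, inv_mul_cancel_right]
        rw [sub_mul _ (1 : MonoidAlgebra ℚ A) (of ℚ A g * _), h2]
        noncomm_ring
      rw [h1]
      refine add_mem (weightFilt_antitone (show l + w ≤ w + i + k by omega) ?_)
        (weightFilt_antitone (show l + w ≤ i + (k + w) by omega) ?_)
      · exact sub_one_mul_mem_weightFilt hcN hci (of_mul_mem_weightFilt hF.zero hg hcv)
      · exact sub_one_mul_mem_weightFilt hg hgi ih
  | zero => rw [mul_zero, zero_mul, sub_self]; exact zero_mem _
  | add u v _ _ hu hv =>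
    rw [mul_add, add_mul, add_sub_add_comm]
    exact add_mem hu hv
  | smul r v _ hv =>
    rw [mul_smul_comm, smul_mul_assoc, ← smul_sub]
    exact Submodule.smul_mem _ _ hv

/-- Every product with at least one factor `g - 1` has augmentation zero. -/
theorem augmentation_sub_one_mul (g : A) (x : MonoidAlgebra ℚ A) :
    MonoidAlgebra.lift ℚ ℚ A 1 ((of ℚ A g - 1) * x) = 0 := by
  rw [map_mul, map_sub, MonoidAlgebra.lift_of, MonoidHom.one_apply,
    map_one (MonoidAlgebra.lift ℚ ℚ A (1 : A →* ℚ)), sub_self, zero_mul]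

/-- The weight filtration of `ℚ[H]` detects the terms `F k` with `k ≤ K` inside `H`. -/
def Detects (F : ℕ → Subgroup A) (K : ℕ) (H : Subgroup A) : Prop :=
  ∀ k ≤ K, ∀ g ∈ H, of ℚ A g - 1 ∈ weightFilt F H k → g ∈ F k

/-- **Adjoining one element.** Let `F (w + 1) ≤ N ≤ H ≤ F w` with `H = N⟨x⟩`, and let `χ` be a
homomorphism on `H`, trivial on `N`, such that `h x^{-χ(h)} ∈ N` for all `h`. If `χ x = 1`, the
extension splits and `H` acts on `ℚ[N]`, with `N` acting by multiplication and `x` by conjugation. The formula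
`v ↦ h v x^{-χ(h)}` for the action shows that it respects weights, so the linear map
`h ↦ h x^{-χ(h)} = h · 1` carries the weight filtration of `ℚ[H]` to that of `ℚ[N]`. -/
theorem Detects.of_splitting (hF : IsRootClosedNSeries A F) {w K : ℕ} (hw : 1 ≤ w)
    (hwN : F (w + 1) ≤ N) (hNH : N ≤ H) (hH : H ≤ F w) {x : A} (hx : x ∈ H) (χ : A → ℤ)
    (hχ : ∀ g ∈ H, ∀ h ∈ H, χ (g * h) = χ g + χ h) (hχN : ∀ g ∈ N, χ g = 0)
    (hr : ∀ g ∈ H, g * x ^ (-χ g) ∈ N) (hN : Detects F K N) : Detects F K H := by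
  have hχ1 : χ 1 = 0 := hχN 1 N.one_mem
  -- the functional `χ` kills everything of weight above `w`
  have hlam : ∀ {k : ℕ} {y : MonoidAlgebra ℚ A}, y ∈ weightFilt F H k → w < k →
      linExtend (fun a => (χ a : ℚ)) y = 0 := by
    intro k y hy hk
    induction hy using Submodule.span_induction with
    | mem y hy =>
      have key : ∀ g ∈ H, ∀ z ∈ subAlg H, linExtend (fun a => (χ a : ℚ)) ((of ℚ A g - 1) * z) =
          χ g * MonoidAlgebra.lift ℚ ℚ A 1 z := by
        intro g hg z hz
        induction hz using Submodule.span_induction with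
        | mem z hz =>
          obtain ⟨h, hh, rfl⟩ := hz
          rw [sub_mul, one_mul, ← map_mul, map_sub, linExtend_of, linExtend_of, hχ g hg h hh,
            MonoidAlgebra.lift_of]
          simp
        | zero => simp
        | add a b _ _ ha hb => rw [mul_add, map_add, ha, hb, map_add, mul_add]
        | smul r a _ ha =>
          rw [mul_smul_comm, map_smul, ha, map_smul, smul_eq_mul, smul_eq_mul, mul_left_comm]
      cases hy with
      | one => omega
      | @mul i k l g z hg hgi hz hl =>
        rw [key g hg z hz.mem_subAlg]
        cases hz with
        | one =>
          rw [hχN g (hwN (hF.antitone (by omega) hgi)), Int.cast_zero, zero_mul]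
        | mul _ _ _ _ => rw [augmentation_sub_one_mul, mul_zero]
    | zero => exact map_zero _
    | add a b _ _ ha hb => rw [map_add, ha, hb, add_zero]
    | smul r a _ ha => rw [map_smul, ha, smul_zero]
  -- the action of `g` on `ℚ[N]` respects weights
  have hact : ∀ {i j : ℕ} {g : A} {v : MonoidAlgebra ℚ A}, g ∈ H → g ∈ F i →
      v ∈ weightFilt F N j → of ℚ A g * v * of ℚ A (x ^ (-χ g)) - v ∈ weightFilt F N (i + j) := by
    intro i j g v hg hgi hv
    rcases le_or_gt i w with hiw | hiw
    · set y := x ^ χ g with hy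
      have hyH : y ∈ H := H.zpow_mem hx _
      have hc := conj_sub_mem_weightFilt hF hw hwN (hNH.trans hH) (hH hyH) hv
      rw [zpow_neg, ← hy]
      have hn : g * y⁻¹ ∈ N := by simpa only [hy, zpow_neg] using hr g hg
      have hni : g * y⁻¹ ∈ F i :=
        hF.antitone hiw ((F w).mul_mem (hH hg) ((F w).inv_mem (hH hyH)))
      have hcv : of ℚ A y * v * of ℚ A y⁻¹ ∈ weightFilt F N j := by
        have := add_mem (weightFilt_antitone (Nat.le_add_right j w) hc) hv
        rwa [sub_add_cancel] at this
      have h1 : of ℚ A g * v * of ℚ A y⁻¹ - v =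
          (of ℚ A (g * y⁻¹) - 1) * (of ℚ A y * v * of ℚ A y⁻¹) +
            (of ℚ A y * v * of ℚ A y⁻¹ - v) := by
        have h2 : of ℚ A (g * y⁻¹) * (of ℚ A y * v * of ℚ A y⁻¹) = of ℚ A g * v * of ℚ A y⁻¹ := by
          simp only [← mul_assoc, ← map_mul, inv_mul_cancel_right]
        rw [sub_mul, h2, one_mul, sub_add_sub_cancel]
      rw [h1]
      exact add_mem (sub_one_mul_mem_weightFilt hn hni hcv)
        (weightFilt_antitone (by omega) hc)
    · have hgN : g ∈ N := hwN (hF.antitone hiw hgi)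
      have := sub_one_mul_mem_weightFilt hgN hgi hv
      rwa [hχN g hgN, neg_zero, zpow_zero, map_one, mul_one, ← sub_one_mul]
  let Ψ : MonoidAlgebra ℚ A →ₗ[ℚ] MonoidAlgebra ℚ A :=
    linExtend fun a => of ℚ A (a * x ^ (-χ a))
  have hΨof : ∀ a, Ψ (of ℚ A a) = of ℚ A (a * x ^ (-χ a)) := fun a => linExtend_of _ a
  have hΨmul : ∀ g ∈ H, ∀ z ∈ subAlg H,
      Ψ (of ℚ A g * z) = of ℚ A g * Ψ z * of ℚ A (x ^ (-χ g)) := by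
    intro g hg z hz
    induction hz using Submodule.span_induction with
    | mem z hz =>
      obtain ⟨h, hh, rfl⟩ := hz
      rw [← map_mul, hΨof, hΨof, hχ g hg h hh, ← map_mul, ← map_mul]
      congr 1
      simp only [mul_assoc, ← zpow_add]
      congr 3
      ring
    | zero => simp
    | add a b _ _ ha hb => rw [mul_add, map_add, ha, hb, map_add, mul_add, add_mul]
    | smul r a _ ha => rw [mul_smul_comm, map_smul, ha, map_smul, mul_smul_comm, smul_mul_assoc]
  have hΨ : ∀ {k : ℕ} {y : MonoidAlgebra ℚ A}, y ∈ weightFilt F H k → Ψ y ∈ weightFilt F N k := by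
    intro k y hy
    induction hy using Submodule.span_induction with
    | mem y hy =>
      induction hy with
      | one =>
        have : Ψ 1 = 1 := by
          rw [← map_one (of ℚ A), hΨof, hχ1, neg_zero, zpow_zero, mul_one]
        rw [this]
        exact one_mem_weightFilt
      | @mul i k l g y hg hgi hy hl ih =>
        rw [sub_mul, one_mul, map_sub, hΨmul g hg y hy.mem_subAlg]
        exact weightFilt_antitone hl (hact hg hgi ih)
    | zero => rw [map_zero]; exact zero_mem _
    | add a b _ _ ha hb => rw [map_add]; exact add_mem ha hb
    | smul r a _ ha => rw [map_smul]; exact Submodule.smul_mem _ _ ha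
  intro k hk g hg hgk
  rcases le_or_gt k w with hkw | hkw
  · exact hF.antitone hkw (hH hg)
  · have hχg : χ g = 0 := by
      have := hlam hgk hkw
      rw [map_sub, ← map_one (of ℚ A), linExtend_of, linExtend_of, hχ1, Int.cast_zero, sub_zero,
        Int.cast_eq_zero] at this
      exact this
    have h := hΨ hgk
    rw [map_sub, ← map_one (of ℚ A), hΨof, hΨof, hχg, hχ1, neg_zero, zpow_zero, mul_one, mul_one,
      map_one] at h
    have hgN := hr g hg
    rw [hχg, neg_zero, zpow_zero, mul_one] at hgN
    exact hN k hk g hgN h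

/-- Adjoining finitely many elements that are independent modulo `F (w + 1)`, with coordinate
functions `c`. -/
theorem Detects.of_coordinates (hF : IsRootClosedNSeries A F) {w K : ℕ} (hw : 1 ≤ w)
    (hwH : F (w + 1) ≤ H) (hH : H ≤ F w) {ι : Type*} [Fintype ι] [DecidableEq ι] (c : A → ι → ℤ)
    (hc : ∀ g ∈ H, ∀ h ∈ H, c (g * h) = c g + c h)
    (hc0 : ∀ g ∈ H, c g = 0 → g ∈ F (w + 1)) (hcw : ∀ g ∈ F (w + 1), c g = 0)
    (hcs : ∀ i, ∃ x ∈ H, c x = Pi.single i 1) (hK : Detects F K (F (w + 1))) : Detects F K H := by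
  have hc1 : c 1 = 0 := hcw 1 (one_mem _)
  have hcinv : ∀ g ∈ H, c g⁻¹ = -c g := fun g hg => by
    have := hc g hg g⁻¹ (inv_mem hg)
    rw [mul_inv_cancel, hc1] at this
    exact eq_neg_of_add_eq_zero_right this.symm
  have hcpow : ∀ g ∈ H, ∀ e : ℤ, c (g ^ e) = e • c g := by
    intro g hg e
    have hnat : ∀ m : ℕ, c (g ^ m) = m • c g := by
      intro m
      induction m with
      | zero => simpa using hc1
      | succ m ih => rw [pow_succ, hc _ (pow_mem hg m) g hg, ih, succ_nsmul]
    obtain ⟨m, rfl | rfl⟩ := e.eq_nat_or_neg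
    · simpa using hnat m
    · rw [zpow_neg, zpow_natCast, hcinv _ (pow_mem hg m), hnat]
      simp
  let T : Finset ι → Subgroup A := fun s =>
    { carrier := {h | h ∈ H ∧ ∀ j ∉ s, c h j = 0}
      one_mem' := ⟨H.one_mem, fun j _ => by rw [hc1]; rfl⟩
      mul_mem' := fun {a b} ha hb => ⟨H.mul_mem ha.1 hb.1, fun j hj => by
        rw [hc a ha.1 b hb.1, Pi.add_apply, ha.2 j hj, hb.2 j hj, add_zero]⟩
      inv_mem' := fun {a} ha => ⟨H.inv_mem ha.1, fun j hj => by
        rw [hcinv a ha.1, Pi.neg_apply, ha.2 j hj, neg_zero]⟩ }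
  have hT : ∀ s, Detects F K (T s) := by
    intro s
    induction s using Finset.induction_on with
    | empty =>
      have : T ∅ = F (w + 1) := by
        ext g
        refine ⟨fun hg => hc0 g hg.1 (funext fun j => hg.2 j (Finset.notMem_empty j)),
          fun hg => ⟨hwH hg, fun j _ => by rw [hcw g hg]; rfl⟩⟩
      rwa [this]
    | insert i s his ih =>
      obtain ⟨x, hxH, hx⟩ := hcs i
      refine Detects.of_splitting hF hw (N := T s) ?_ ?_ (fun g hg => hH hg.1) (x := x) ?_
        (fun g => c g i) ?_ ?_ ?_ ih
      · exact fun g hg => ⟨hwH hg, fun j _ => by rw [hcw g hg]; rfl⟩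
      · exact fun g hg => ⟨hg.1, fun j hj => hg.2 j fun h => hj (Finset.mem_insert_of_mem h)⟩
      · refine ⟨hxH, fun j hj => ?_⟩
        rw [hx, Pi.single_eq_of_ne]
        rintro rfl
        exact hj (Finset.mem_insert_self _ _)
      · intro g hg h hh
        simp only [hc g hg.1 h hh.1, Pi.add_apply]
      · exact fun g hg => hg.2 i his
      · intro g hg
        refine ⟨H.mul_mem hg.1 (H.zpow_mem hxH _), fun j hj => ?_⟩
        rw [hc g hg.1 _ (H.zpow_mem hxH _), hcpow x hxH, hx, Pi.add_apply, Pi.smul_apply]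
        by_cases hji : j = i
        · subst hji
          simp
        · rw [Pi.single_eq_of_ne hji, smul_zero, add_zero]
          exact hg.2 j fun h => (Finset.mem_insert.1 h).elim hji hj
  have : T Finset.univ = H := by
    ext g
    exact ⟨fun hg => hg.1, fun hg => ⟨hg, fun j hj => absurd (Finset.mem_univ j) hj⟩⟩
  rw [← this]
  exact hT _

end GroupAlgebra

/-! ### The theorem of Lazard and Jennings -/

section Detection

variable {A : Type u} [Group A] {F : ℕ → Subgroup A}

/-- One step of the descent. The quotient `F w / F (w + 1)` is a torsion-free abelian group, so its
finitely generated subgroups are free, and finitely many elements at a time suffice. -/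
theorem Detects.of_succ (hF : IsRootClosedNSeries A F) {w K : ℕ} (hw : 1 ≤ w)
    (hK : Detects F K (F (w + 1))) : Detects F K (F w) := by
  classical
  intro k hk g hg hgk
  obtain ⟨S₀, hS₀, hS₀w, hS₀k⟩ := exists_finite_of_mem_weightFilt hgk
  -- `g` itself has to lie in the subgroup generated
  let S := insert g S₀
  have hS : S.Finite := hS₀.insert g
  have hSw : S ⊆ F w := Set.insert_subset hg hS₀w
  let N := (F (w + 1)).subgroupOf (F w)
  have hcomm : ∀ a ∈ F w, ∀ b ∈ F w, a * b * a⁻¹ * b⁻¹ ∈ F (w + 1) := fun a ha b hb =>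
    hF.antitone (by omega) (hF.commutator_le w w (Subgroup.commutator_mem_commutator ha hb))
  have hNn : N.Normal := ⟨fun n hn a => by
    have := mul_mem (hcomm a a.2 n n.2) hn
    rw [Subgroup.mem_subgroupOf]
    simpa using this⟩
  let _ : CommGroup (F w ⧸ N) :=
    { (inferInstance : Group (F w ⧸ N)) with
      mul_comm := fun x y => by
        obtain ⟨a, rfl⟩ := QuotientGroup.mk_surjective x
        obtain ⟨b, rfl⟩ := QuotientGroup.mk_surjective y
        rw [← QuotientGroup.mk_mul, ← QuotientGroup.mk_mul, QuotientGroup.eq,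
          Subgroup.mem_subgroupOf]
        have := hcomm _ (inv_mem b.2) _ (inv_mem a.2)
        simpa [mul_assoc] using this }
  let V := Additive (F w ⧸ N)
  let β : F w → V := fun a => Additive.ofMul (QuotientGroup.mk a)
  have hβmul : ∀ a b, β (a * b) = β a + β b := fun a b => rfl
  have hβinv : ∀ a, β a⁻¹ = -β a := fun a => rfl
  have hβ1 : β 1 = 0 := rfl
  have hβ0 : ∀ a, β a = 0 ↔ (a : A) ∈ F (w + 1) := fun a => QuotientGroup.eq_one_iff a
  have hβs : Function.Surjective β := fun v => QuotientGroup.mk_surjective v.toMul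
  have htf : Module.IsTorsionFree ℤ V := by
    refine Module.isTorsionFree_iff_smul_eq_zero.2 fun m v hmv => ?_
    obtain ⟨a, rfl⟩ := hβs v
    by_contra! hcon
    obtain ⟨hm, ha⟩ := hcon
    apply ha
    rw [hβ0]
    have hpow : ∀ m : ℕ, β (a ^ m) = m • β a := fun m => rfl
    have hnat : m.natAbs • β a = 0 := by
      rcases Int.natAbs_eq m with h | h
      · rwa [h, natCast_zsmul] at hmv
      · rwa [h, neg_smul, neg_eq_zero, natCast_zsmul] at hmv
    rw [← hpow, hβ0] at hnat
    exact hF.root_mem (Int.natAbs_pos.2 hm) hnat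
  let L : Submodule ℤ V := Submodule.span ℤ (β '' {a | (a : A) ∈ S})
  have hfin : (β '' {a | (a : A) ∈ S}).Finite :=
    (hS.preimage Subtype.val_injective.injOn).image β
  have : Module.Finite ℤ L := Module.Finite.span_of_finite ℤ hfin
  have : Module.Free ℤ L := Module.free_of_finite_type_torsion_free'
  let b := Module.finBasis ℤ L
  let H : Subgroup A :=
    { carrier := {a | ∃ ha : a ∈ F w, β ⟨a, ha⟩ ∈ L}
      one_mem' := ⟨one_mem _, zero_mem L⟩
      mul_mem' := fun {x y} hx hy => ⟨mul_mem hx.1 hy.1, add_mem hx.2 hy.2⟩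
      inv_mem' := fun {x} hx => ⟨inv_mem hx.1, neg_mem hx.2⟩ }
  let c : A → Fin (Module.finrank ℤ L) → ℤ := fun a =>
    if h : ∃ ha : a ∈ F w, β ⟨a, ha⟩ ∈ L then b.equivFun ⟨β ⟨a, h.1⟩, h.2⟩ else 0
  have hcH : ∀ a (h : ∃ ha : a ∈ F w, β ⟨a, ha⟩ ∈ L), c a = b.equivFun ⟨β ⟨a, h.1⟩, h.2⟩ :=
    fun a h => dif_pos h
  have hwH : F (w + 1) ≤ H := fun a ha =>
    ⟨hF.antitone w.le_succ ha, by
      rw [(hβ0 ⟨a, hF.antitone w.le_succ ha⟩).2 ha]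
      exact zero_mem L⟩
  have hH : Detects F K H := by
    refine Detects.of_coordinates hF hw hwH (fun a ha => ha.1) c ?_ ?_ ?_ ?_ hK
    · intro x hx y hy
      rw [hcH _ (mul_mem hx hy : x * y ∈ H), hcH x hx, hcH y hy, ← map_add]
      rfl
    · intro x hx h0
      rw [hcH x hx, LinearEquiv.map_eq_zero_iff, Subtype.ext_iff] at h0
      exact (hβ0 ⟨x, hx.1⟩).1 h0
    · intro x hx
      rw [hcH x (hwH hx), LinearEquiv.map_eq_zero_iff, Subtype.ext_iff]
      exact (hβ0 _).2 hx
    · intro i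
      obtain ⟨a, ha⟩ := hβs (b i)
      have haH : ∃ ha : (a : A) ∈ F w, β ⟨a, ha⟩ ∈ L :=
        ⟨a.2, by rw [Subtype.coe_eta, ha]; exact (b i).2⟩
      refine ⟨a, haH, ?_⟩
      have : (⟨β ⟨a, haH.1⟩, haH.2⟩ : L) = b i := Subtype.ext ha
      rw [hcH a haH, this]
      ext j
      rw [Module.Basis.equivFun_self, Pi.single_apply]
      simp only [eq_comm]
  have hSH : S ⊆ (H : Set A) := fun a ha =>
    ⟨hSw ha, Submodule.subset_span ⟨⟨a, hSw ha⟩, ha, rfl⟩⟩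
  exact hH k hk g (hSH (Set.mem_insert _ _)) (hS₀k H ((Set.subset_insert _ _).trans hSH))

/-- **Lazard, Jennings.** The weight filtration of the rational group algebra detects a root-closed
`N`-series. -/
theorem mem_of_sub_one_mem_weightFilt (hF : IsRootClosedNSeries A F) {k : ℕ} {g : A}
    (hg : of ℚ A g - 1 ∈ weightFilt F ⊤ k) : g ∈ F k := by
  rcases Nat.eq_zero_or_pos k with rfl | hk
  · rw [hF.zero]
    trivial
  have hbase : Detects F k (F k) := fun j hj a ha _ => hF.antitone hj ha
  have h1 : Detects F k (F 1) := Nat.decreasingInduction' (P := fun w => Detects F k (F w))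
    (fun w _ hw h => h.of_succ hF hw) hk hbase
  rw [hF.one] at h1
  exact h1 k le_rfl g (Subgroup.mem_top g) hg

variable (A) in
/-- The rational lower central series, reindexed by weight. -/
theorem isRootClosedNSeries_rTerm_rat :
    IsRootClosedNSeries A (fun i => rTerm A .rat (i - 1)) where
  zero := rfl
  one := rfl
  antitone _ _ h := rTerm_antitone (Nat.sub_le_sub_right h 1)
  commutator_le i j := by
    rcases Nat.eq_zero_or_pos i with rfl | hi
    · rw [zero_add]
      exact Subgroup.commutator_le_right _ _
    rcases Nat.eq_zero_or_pos j with rfl | hj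
    · exact Subgroup.commutator_le_left _ _
    exact (commutator_rTerm_rat_le _ _).trans_eq
      (by rw [show i - 1 + (j - 1) + 1 = i + j - 1 by omega])
  root_mem hk hx := mem_rTerm_rat_of_pow_mem hk hx

end Detection

/-! ### Unit groups as rational towers -/

section UnipotentUnits

variable {S : Type u} [Ring S] [Algebra ℚ S]

/-- A descending multiplicative filtration of a `ℚ`-algebra by submodules, with `E (n + 1) = 0`. -/
structure IsNilpotentFiltration (E : ℕ → Submodule ℚ S) (n : ℕ) : Prop where
  zero : E 0 = ⊤
  antitone : Antitone E
  mul_mem : ∀ {i j : ℕ} {x y : S}, x ∈ E i → y ∈ E j → x * y ∈ E (i + j)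
  eq_bot : E (n + 1) = ⊥

variable {E : ℕ → Submodule ℚ S} {n : ℕ}

theorem IsNilpotentFiltration.mul_mem_left (hE : IsNilpotentFiltration E n) {i : ℕ} (s : S) {x : S}
    (hx : x ∈ E i) : s * x ∈ E i := by
  have := hE.mul_mem (i := 0) (show s ∈ E 0 by rw [hE.zero]; trivial) hx
  rwa [zero_add] at this

theorem IsNilpotentFiltration.mul_mem_right (hE : IsNilpotentFiltration E n) {i : ℕ} (s : S)
    {x : S} (hx : x ∈ E i) : x * s ∈ E i :=
  hE.mul_mem (j := 0) hx (show s ∈ E 0 by rw [hE.zero]; trivial)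

/-- The units congruent to `1` modulo the `i`-th term of the filtration. -/
def congruenceUnits (hE : IsNilpotentFiltration E n) (i : ℕ) : Subgroup Sˣ where
  carrier := {u | (u : S) - 1 ∈ E i}
  one_mem' := by simp
  mul_mem' {u v} hu hv := by
    have : ((u * v : Sˣ) : S) - 1 = u * (v - 1) + (u - 1) := by push_cast; noncomm_ring
    change ((u * v : Sˣ) : S) - 1 ∈ E i
    rw [this]
    exact add_mem (hE.mul_mem_left _ hv) hu
  inv_mem' {u} hu := by
    have : ((u⁻¹ : Sˣ) : S) - 1 = -(((u⁻¹ : Sˣ) : S) * (u - 1)) := by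
      rw [mul_sub, Units.inv_mul, mul_one, neg_sub]
    change ((u⁻¹ : Sˣ) : S) - 1 ∈ E i
    rw [this]
    exact neg_mem (hE.mul_mem_left _ hu)

theorem mem_congruenceUnits (hE : IsNilpotentFiltration E n) {i : ℕ} {u : Sˣ} :
    u ∈ congruenceUnits hE i ↔ (u : S) - 1 ∈ E i := Iff.rfl

instance (hE : IsNilpotentFiltration E n) (i : ℕ) : (congruenceUnits hE i).Normal :=
  ⟨fun u hu g => by
    have : ((g * u * g⁻¹ : Sˣ) : S) - 1 = g * (u - 1) * ((g⁻¹ : Sˣ) : S) := by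
      push_cast
      rw [mul_sub, sub_mul, mul_one, Units.mul_inv]
    rw [mem_congruenceUnits, this]
    exact hE.mul_mem_right _ (hE.mul_mem_left _ hu)⟩

/-- The quotient of the group of units `≡ 1` modulo `E 1` by those `≡ 1` modulo `E (i + 1)`. -/
abbrev unitQuotient (hE : IsNilpotentFiltration E n) (i : ℕ) : Type u :=
  congruenceUnits hE 1 ⧸ (congruenceUnits hE (i + 1)).subgroupOf (congruenceUnits hE 1)

theorem unitQuotient_mk_eq_iff (hE : IsNilpotentFiltration E n) {i : ℕ}
    (u v : congruenceUnits hE 1) :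
    (u : unitQuotient hE i) = v ↔ ((v : Sˣ) : S) - ((u : Sˣ) : S) ∈ E (i + 1) := by
  rw [QuotientGroup.eq, Subgroup.mem_subgroupOf, mem_congruenceUnits]
  have h1 : (((u⁻¹ * v : congruenceUnits hE 1) : Sˣ) : S) - 1 =
      (((u : Sˣ)⁻¹ : Sˣ) : S) * (((v : Sˣ) : S) - ((u : Sˣ) : S)) := by
    rw [mul_sub, Units.inv_mul]
    rfl
  rw [h1]
  refine ⟨fun h => ?_, fun h => hE.mul_mem_left _ h⟩
  have := hE.mul_mem_left ((u : Sˣ) : S) h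
  rwa [← mul_assoc, Units.mul_inv, one_mul] at this

theorem exists_unit_eq_one_add (hE : IsNilpotentFiltration E n) {i : ℕ} {e : S}
    (he : e ∈ E (i + 1)) : ∃ u : congruenceUnits hE 1, ((u : Sˣ) : S) = 1 + e := by
  have hpow : ∀ m, e ^ m ∈ E m := by
    intro m
    induction m with
    | zero => rw [hE.zero]; trivial
    | succ m ih =>
      rw [pow_succ]
      exact hE.mul_mem ih (hE.antitone (Nat.le_add_left 1 i) he)
  have hnil : IsNilpotent e := ⟨n + 1, by
    have := hpow (n + 1)
    rwa [hE.eq_bot, Submodule.mem_bot] at this⟩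
  obtain ⟨u, hu⟩ := hnil.isUnit_one_add
  refine ⟨⟨u, ?_⟩, hu⟩
  rw [mem_congruenceUnits, hu, add_sub_cancel_left]
  exact hE.antitone (Nat.le_add_left 1 i) he

/-- The group of units `≡ 1` modulo `E 1` is a tower of central extensions by the rational vector
spaces `E i / E (i + 1)`. -/
theorem isTower_unitQuotient (hE : IsNilpotentFiltration E n) (i : ℕ) :
    IsTower .rat i (unitQuotient hE i) := by
  induction i with
  | zero =>
    change Subsingleton (_ ⧸ _)
    rw [zero_add, Subgroup.subgroupOf_self]
    exact QuotientGroup.subsingleton_quotient_top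
  | succ i ih =>
    let π : unitQuotient hE (i + 1) →* unitQuotient hE i :=
      QuotientGroup.map _ _ (MonoidHom.id _)
        (fun u hu => hE.antitone (Nat.le_succ (i + 1)) hu)
    have hπ : Function.Surjective π := fun q => by
      obtain ⟨a, rfl⟩ := QuotientGroup.mk_surjective q
      exact ⟨a, rfl⟩
    let D := (E (i + 2)).comap (E (i + 1)).subtype
    let M := E (i + 1) ⧸ D
    choose rep hrep using Submodule.Quotient.mk_surjective D
    have hout : ∀ m : M, ∃ u : congruenceUnits hE 1,
        ((u : Sˣ) : S) = 1 + ((rep m : E (i + 1)) : S) := fun m =>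
      exists_unit_eq_one_add hE (rep m).2
    choose v hv using hout
    have hM : ∀ m m' : M, m = m' ↔
        ((rep m' : E (i + 1)) : S) - ((rep m : E (i + 1)) : S) ∈ E (i + 2) := by
      intro m m'
      conv_lhs => rw [← hrep m, ← hrep m', eq_comm]
      exact Submodule.Quotient.eq D
    have hadd : ∀ m m' : M, (rep (m + m') : S) - rep m - rep m' ∈
        E (i + 2) := by
      intro m m'
      have : (rep (m + m') : E (i + 1)) - (rep m + rep m') ∈ D := by
        rw [← Submodule.Quotient.eq, Submodule.Quotient.mk_add, hrep, hrep, hrep]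
      rw [sub_sub]
      exact this
    let ι : Multiplicative M →* unitQuotient hE (i + 1) :=
      MonoidHom.mk' (fun m => (v m.toAdd : unitQuotient hE (i + 1))) fun m m' => by
        rw [← QuotientGroup.mk_mul, unitQuotient_mk_eq_iff, toAdd_mul, Subgroup.coe_mul,
          Units.val_mul, hv, hv, hv]
        have h1 : ∀ x y z : S, (1 + x) * (1 + y) - (1 + z) = x * y - (z - x - y) := by
          intro x y z
          noncomm_ring
        rw [h1]
        exact sub_mem (hE.antitone (by omega) (hE.mul_mem (Subtype.prop _) (Subtype.prop _)))
          (hadd _ _)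
    have hιv : ∀ m : M, ι (Multiplicative.ofAdd m) = (v m : unitQuotient hE (i + 1)) :=
      fun m => rfl
    let _ : Module (CoeffRing.Carrier.{u} .rat) M := Module.compHom M carrierRatEquiv.toRingHom
    refine ⟨unitQuotient hE i, inferInstance, π, M, inferInstance, inferInstance, ι, hπ, ?_, ?_, ?_,
      ih⟩
    · intro m m' h
      change (v m.toAdd : unitQuotient hE (i + 1)) = v m'.toAdd at h
      rw [unitQuotient_mk_eq_iff, hv, hv, add_sub_add_left_eq_sub] at h
      exact Multiplicative.toAdd.injective ((hM _ _).2 h)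
    · ext x
      constructor
      · rintro ⟨m, rfl⟩
        change (v m.toAdd : unitQuotient hE i) = ((1 : congruenceUnits hE 1) : unitQuotient hE i)
        rw [eq_comm, unitQuotient_mk_eq_iff, hv]
        simp
      · obtain ⟨u, rfl⟩ := QuotientGroup.mk_surjective x
        intro hu
        change (u : unitQuotient hE i) = ((1 : congruenceUnits hE 1) : unitQuotient hE i) at hu
        rw [eq_comm, unitQuotient_mk_eq_iff] at hu
        refine ⟨Multiplicative.ofAdd (Submodule.Quotient.mk ⟨_, hu⟩), ?_⟩
        rw [hιv, unitQuotient_mk_eq_iff, hv]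
        have := (Submodule.Quotient.eq D).1
          (hrep (Submodule.Quotient.mk (p := D) ⟨_, hu⟩)).symm
        rw [← sub_sub]
        exact this
    · intro m e
      obtain ⟨u, rfl⟩ := QuotientGroup.mk_surjective e
      change (v m.toAdd : unitQuotient hE (i + 1)) * u = u * v m.toAdd
      rw [← QuotientGroup.mk_mul, ← QuotientGroup.mk_mul, unitQuotient_mk_eq_iff, Subgroup.coe_mul,
        Subgroup.coe_mul, Units.val_mul, Units.val_mul, hv]
      have h1 : ∀ x y : S, y * (1 + x) - (1 + x) * y = (y - 1) * x - x * (y - 1) := by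
        intro x y
        noncomm_ring
      rw [h1]
      have hu : ((u : Sˣ) : S) - 1 ∈ E 1 := u.2
      exact sub_mem (hE.antitone (by omega) (hE.mul_mem hu (Subtype.prop _)))
        (hE.mul_mem (Subtype.prop _) hu)

end UnipotentUnits

/-! ### The rational tower of a group and Dwyer's theorem -/

section RationalTower

variable {A : Type u} [Group A] {F : ℕ → Subgroup A}

theorem mul_mem_weightFilt_top {i j : ℕ} {x y : MonoidAlgebra ℚ A} (hx : x ∈ weightFilt F ⊤ i)
    (hy : y ∈ weightFilt F ⊤ j) : x * y ∈ weightFilt F ⊤ (i + j) := by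
  induction hx using Submodule.span_induction with
  | mem x hx =>
    induction hx with
    | one => rwa [one_mul, zero_add]
    | mul hg hgi _ hl ih =>
      rw [mul_assoc]
      exact weightFilt_antitone (by omega) (sub_one_mul_mem_weightFilt hg hgi ih)
  | zero => rw [zero_mul]; exact zero_mem _
  | add a b _ _ ha hb => rw [add_mul]; exact add_mem ha hb
  | smul r a _ ha => rw [smul_mul_assoc]; exact Submodule.smul_mem _ _ ha

theorem weightFilt_top_zero (hF0 : F 0 = ⊤) : weightFilt F ⊤ 0 = ⊤ := by
  refine eq_top_iff.2 fun x _ => ?_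
  induction x using MonoidAlgebra.induction_on with
  | of a => simpa using of_mul_mem_weightFilt hF0 (Subgroup.mem_top a) one_mem_weightFilt
  | add x y hx hy => exact add_mem (hx trivial) (hy trivial)
  | smul r x hx => exact Submodule.smul_mem _ _ (hx trivial)

/-- The terms of the weight filtration of `ℚ[A]` are ideals. -/
noncomputable def weightIdeal (hF0 : F 0 = ⊤) (k : ℕ) : Ideal (MonoidAlgebra ℚ A) where
  carrier := weightFilt F ⊤ k
  zero_mem' := zero_mem _
  add_mem' := add_mem
  smul_mem' x y hy := by
    have := mul_mem_weightFilt_top (i := 0) (by rw [weightFilt_top_zero hF0]; trivial : x ∈ _) hy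
    rwa [zero_add] at this

instance (hF0 : F 0 = ⊤) (k : ℕ) : (weightIdeal hF0 k).IsTwoSided :=
  ⟨fun {x} y hx => mul_mem_weightFilt_top (j := 0) (show x ∈ weightFilt F ⊤ k from hx)
    (by rw [weightFilt_top_zero hF0]; trivial)⟩

/-- For a root-closed `N`-series `F`, the quotient `A / F (n + 1)` embeds in a rational tower of
height `n`: the units `≡ 1` in the quotient of `ℚ[A]` by the elements of weight at least `n + 1`. -/
theorem exists_isTower_rat (hF : IsRootClosedNSeries A F) (n : ℕ) :
    ∃ (G : Type u) (_ : Group G) (φ : A →* G), IsTower .rat n G ∧ φ.ker ≤ F (n + 1) := by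
  let I := weightIdeal hF.zero (n + 1)
  let q : MonoidAlgebra ℚ A →ₐ[ℚ] MonoidAlgebra ℚ A ⧸ I := Ideal.Quotient.mkₐ ℚ I
  have hq : Function.Surjective q := Ideal.Quotient.mkₐ_surjective ℚ I
  let E : ℕ → Submodule ℚ (MonoidAlgebra ℚ A ⧸ I) := fun i =>
    (weightFilt F ⊤ i).map q.toLinearMap
  have hq0 : ∀ x, q x = 0 ↔ x ∈ weightFilt F ⊤ (n + 1) := fun x => Ideal.Quotient.eq_zero_iff_mem
  have hE : IsNilpotentFiltration E n :=
    { zero := by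
        simp only [E, weightFilt_top_zero hF.zero, Submodule.map_top]
        exact LinearMap.range_eq_top.2 hq
      antitone := fun i j h => Submodule.map_mono (weightFilt_antitone h)
      mul_mem := by
        rintro i j _ _ ⟨x, hx, rfl⟩ ⟨y, hy, rfl⟩
        exact ⟨x * y, mul_mem_weightFilt_top hx hy, map_mul q x y⟩
      eq_bot := by
        refine LinearMap.le_ker_iff_map.1 fun x hx => ?_
        exact (hq0 x).2 hx }
  let φ₀ : A →* (MonoidAlgebra ℚ A ⧸ I)ˣ :=
    ((q : MonoidAlgebra ℚ A →* MonoidAlgebra ℚ A ⧸ I).comp (of ℚ A)).toHomUnits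
  have hφ₀ : ∀ a, (φ₀ a : MonoidAlgebra ℚ A ⧸ I) - 1 = q (of ℚ A a - 1) := fun a => by
    rw [map_sub, map_one]
    rfl
  let φ : A →* congruenceUnits hE 1 := φ₀.codRestrict _ fun a => by
    rw [mem_congruenceUnits, hφ₀]
    exact Submodule.mem_map_of_mem (f := q.toLinearMap)
      (sub_one_mem_weightFilt (Subgroup.mem_top a) (by rw [hF.one]; trivial))
  refine ⟨unitQuotient hE n, inferInstance, (QuotientGroup.mk' _).comp φ,
    isTower_unitQuotient hE n, fun a ha => ?_⟩
  have h1 : φ a ∈ (congruenceUnits hE (n + 1)).subgroupOf (congruenceUnits hE 1) :=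
    (QuotientGroup.eq_one_iff _).1 ha
  rw [Subgroup.mem_subgroupOf, mem_congruenceUnits, hE.eq_bot, Submodule.mem_bot] at h1
  exact mem_of_sub_one_mem_weightFilt hF ((hq0 _).1 ((hφ₀ a).symm.trans h1))

/-- **Dwyer's theorem**: maps in the `n`-th Dwyer class reflect membership in `A^R_{n+1}`. -/
theorem mem_rTerm_of_map_mem_rTerm {R : CoeffRing} {n : ℕ} {B : Type u} [Group B] {f : A →* B}
    (hf : dwyerClass R n A B f) {a : A} (ha : f a ∈ rTerm B R n) : a ∈ rTerm A R n := by
  by_cases hR : R = .rat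
  · subst hR
    obtain ⟨G, _, φ, hG, hφ⟩ := exists_isTower_rat (isRootClosedNSeries_rTerm_rat A) n
    exact hG.mem_rTerm_of_map_mem hφ hf ha
  · exact (isTower_quotient hR n A).mem_rTerm_of_map_mem (QuotientGroup.ker_mk' _).le hf ha

theorem lowerCentralSeries_le_rTerm (R : CoeffRing) (n : ℕ) (A : Type u) [Group A] :
    (⊤ : Subgroup A).lowerCentralSeries n ≤ rTerm A R n := by
  induction n with
  | zero => exact le_top
  | succ n ih =>
    have h : (⊤ : Subgroup A).lowerCentralSeries (n + 1) ≤ ⁅rTerm A R n, (⊤ : Subgroup A)⁆ :=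
      Subgroup.commutator_mono ih le_rfl
    refine h.trans ?_
    cases R with
    | int => exact (Subgroup.commutator_comm _ _).le
    | rat =>
      rw [Subgroup.commutator_comm]
      exact commutator_top_rTerm_rat_le n
    | zmod p hp => exact le_sup_right

/-- A series contained in the `R`-lower central series stabilizes to it. -/
theorem stabilization_eq_of_le {R : CoeffRing} {Γ : NormalSeries.{u}}
    (hΓ : ∀ (n : ℕ) (A : Type u) [Group A], (Γ.term n).sub A ≤ rTerm A R n) (n : ℕ)
    (A : Type u) [Group A] :
    (Γ.term n).stabilization (dwyerClass R n) A = (rTerm A R n : Set A) := by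
  ext a
  constructor
  · rintro ⟨B, _, f, hf, hfa⟩
    exact mem_rTerm_of_map_mem_rTerm hf (hΓ n B hfa)
  · intro ha
    -- the `0`-th term is the whole group, and `H⁰ = H¹` has no map `A → 1` in general
    cases n with
    | zero => exact ⟨A, inferInstance, MonoidHom.id A, dwyerClass_id 0, by
        rw [Γ.zero_eq]; trivial⟩
    | succ n =>
      refine ⟨A ⧸ rTerm A R (n + 1), inferInstance, _, dwyerClass_mk n, ?_⟩
      rw [QuotientGroup.mk'_apply, (QuotientGroup.eq_one_iff a).2 ha]
      exact one_mem _

end RationalTower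

end DwyerStability

theorem proposition3p3 (R : DwyerStability.CoeffRing) :
    (∀ (n : ℕ) (A : Type u) [Group A],
      (DwyerStability.lowerCentral.{u}.term n).stabilization (DwyerStability.dwyerClass R n) A =
        (((DwyerStability.rLowerCentralSeries R).term n).sub A : Set A)) ∧
    (∀ Γ : DwyerStability.NormalSeries.{u},
      Γ.IsInvariant (DwyerStability.dwyerClass R) →
      (∀ (n : ℕ) (A : Type u) [Group A],
        (Γ.term n).sub A ≤ ((DwyerStability.rLowerCentralSeries R).term n).sub A) →
      ∀ (n : ℕ) (A : Type u) [Group A],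
        (Γ.term n).stabilization (DwyerStability.dwyerClass R n) A =
          (((DwyerStability.rLowerCentralSeries R).term n).sub A : Set A)) :=
  ⟨fun n A _ => DwyerStability.stabilization_eq_of_le
      (DwyerStability.lowerCentralSeries_le_rTerm R) n A,
    fun _ _ hΓ n A _ => DwyerStability.stabilization_eq_of_le hΓ n A⟩
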